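/- For $\tau\in\mathbb{C}$ with $\operatorname{Im}\tau>0$ put $q=e^{2\pi i\tau}$, and let $\eta(\tau)=e^{2\pi i\tau/24}\prod_{n=1}^{\infty}(1-q^n)$ and $\Delta(\tau)=\eta(\tau)^{24}$. Define $$s_2(\tau)=-\frac{\Delta\left(\tau+\frac12\right)}{\Delta(2\tau+1)},$$ $$s_3(\tau)=\left(27\left(\frac{\eta(3\tau)}{\eta(\tau)}\right)^6+\left(\frac{\eta(\tau)}{\eta(3\tau)}\right)^6\right)^2,$$ $$s_4(\tau)=\frac{\Delta(2\tau)}{\Delta(\tau)}\left(16\left(\frac{\eta(\tau)\eta(4\tau)^2}{\eta(2\tau)^3}\right)^4+\left(\frac{\eta(2\tau)^3}{\eta(\tau)\eta(4\tau)^2}\right)^4\right)^4.$$ Then, writing $\sqrt{-m}=i\sqrt m$ for $m>0$, $$s_2\left(\tfrac{\sqrt{-1}}{2}\right)=64,\quad s_2\left(\tfrac{\sqrt{-3}}{2}\right)=256,$$ $$s_3\left(\tfrac{\sqrt{-3}}{3}\right)=108,\quad s_3\left(\tfrac{\sqrt{-6}}{3}\right)=216,\quad s_3\left(\tfrac{\sqrt{-12}}{3}\right)=1458,$$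 $$s_4\left(\tfrac{\sqrt{-2}}{2}\right)=256,\quad s_4\left(\tfrac{\sqrt{-4}}{2}\right)=648,\quad s_4\left(\tfrac{\sqrt{-6}}{2}\right)=2304,\quad s_4\left(\tfrac{\sqrt{-10}}{2}\right)=20736,\quad s_4\left(\tfrac{\sqrt{-18}}{2}\right)=614656.$$ -/

import Mathlib

open ModularForm (eta)

noncomputable section

/-- The modular discriminant `Δ(τ) = η(τ) ^ 24`, where `η` is Mathlib's Dedekind eta function
`η(τ) = e ^ (2πiτ / 24) * ∏_{n ≥ 1} (1 - q ^ n)` with `q = e ^ (2πiτ)`. It agrees with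
`ModularForm.discriminant` on the upper half-plane. -/
def modularDelta (τ : ℂ) : ℂ := eta τ ^ 24

/-- The modular function `s₂(q(τ))`, as a function of `τ` in the upper half-plane. -/
def s₂ (τ : ℂ) : ℂ := -(modularDelta (τ + 1 / 2) / modularDelta (2 * τ + 1))

/-- The modular function `s₃(q(τ))`, as a function of `τ` in the upper half-plane. -/
def s₃ (τ : ℂ) : ℂ :=
  (27 * (eta (3 * τ) / eta τ) ^ 6 + (eta τ / eta (3 * τ)) ^ 6) ^ 2

/-- The modular function `s₄(q(τ))`, as a function of `τ` in the upper half-plane. -/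
def s₄ (τ : ℂ) : ℂ :=
  modularDelta (2 * τ) / modularDelta τ *
    (16 * (eta τ * eta (4 * τ) ^ 2 / eta (2 * τ) ^ 3) ^ 4 +
      (eta (2 * τ) ^ 3 / (eta τ * eta (4 * τ) ^ 2)) ^ 4) ^ 4

/-- The square root of `-m` in the closed upper half-plane, `√(-m) = i √m`. -/
def sqrtNeg (m : ℕ) : ℂ := Complex.I * (Real.sqrt m : ℂ)

end

/-! All arguments lie on the imaginary axis, where `eta` is the positive real function `etaImag`.
There `s₂_I_mul`, `s₃_I_mul` and `s₄_I_mul` express the three functions through eta quotients, so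
each value requires only an algebraic relation between eta values.

These relations have two sources. One is inversion, `etaImag_inv_sq`, which links the values at y
and 1/y. The other is a set of modular equations: Jacobi's quartic identity and equations of degree
three and five. The Jacobi triple product `thetaSum_eq_qProd` turns theta series into eta quotients.
A product of two theta series is a sum over ℤ × ℤ, and splitting it along cosets of a sublattice of
index two or five gives the theta identities.

For a suitable y, inversion pairs off arguments of a modular equation, which becomes a polynomial
system in a few ratios of eta values. Elimination solves the system, and positivity of the ratios
discards the spurious factors. At fixed points of τ ↦ -1/(Nτ), inversion alone is enough. -/

open Filter Topology

/-! ### Infinite q-products. -/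

/-- The infinite product `∏_{n ≥ 0} (1 + c x ^ n)`. -/
noncomputable def qProd (c x : ℝ) : ℝ := ∏' n : ℕ, (1 + c * x ^ n)

lemma summable_norm_const_mul_pow (c : ℝ) {x : ℝ} (h0 : 0 ≤ x) (h1 : x < 1) :
    Summable fun n : ℕ ↦ ‖c * x ^ n‖ := by
  simp_rw [norm_mul, norm_pow, Real.norm_of_nonneg h0]
  exact (summable_geometric_of_lt_one h0 h1).mul_left _

lemma multipliable_one_add_const_mul_pow (c : ℝ) {x : ℝ} (h0 : 0 ≤ x) (h1 : x < 1) :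
    Multipliable fun n : ℕ ↦ 1 + c * x ^ n :=
  multipliable_one_add_of_summable (summable_norm_const_mul_pow c h0 h1)

lemma tendsto_qProd (c : ℝ) {x : ℝ} (h0 : 0 ≤ x) (h1 : x < 1) :
    Tendsto (fun N : ℕ ↦ ∏ n ∈ Finset.range N, (1 + c * x ^ n)) atTop (𝓝 (qProd c x)) :=
  (multipliable_one_add_const_mul_pow c h0 h1).tendsto_prod_tprod_nat

lemma qProd_mul_neg (c : ℝ) {x : ℝ} (h0 : 0 ≤ x) (h1 : x < 1) :
    qProd c x * qProd (-c) x = qProd (-c ^ 2) (x ^ 2) := by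
  rw [qProd, qProd, ← (multipliable_one_add_const_mul_pow c h0 h1).tprod_mul
    (multipliable_one_add_const_mul_pow (-c) h0 h1)]
  exact tprod_congr fun n ↦ by ring

lemma qProd_eq_mul (c : ℝ) {x : ℝ} (h0 : 0 ≤ x) (h1 : x < 1) :
    qProd c x = (1 + c) * qProd (c * x) x := by
  refine tendsto_nhds_unique ((tendsto_qProd c h0 h1).comp (tendsto_add_atTop_nat 1)) ?_
  refine ((tendsto_qProd (c * x) h0 h1).const_mul (1 + c)).congr fun N ↦ ?_
  simp only [Function.comp, Finset.prod_range_succ', pow_zero, mul_one]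
  rw [mul_comm]
  congr 1
  exact Finset.prod_congr rfl fun n _ ↦ by ring

lemma prod_range_mul_eq_prod_prod (f : ℕ → ℝ) (k N : ℕ) :
    ∏ n ∈ Finset.range (k * N), f n =
      ∏ j ∈ Finset.range k, ∏ n ∈ Finset.range N, f (k * n + j) := by
  induction N with
  | zero => simp
  | succ N ih =>
    rw [Nat.mul_succ, Finset.prod_range_add, ih, ← Finset.prod_mul_distrib]
    exact Finset.prod_congr rfl fun j _ ↦ (Finset.prod_range_succ _ _).symm

lemma qProd_eq_prod (c : ℝ) {x : ℝ} (h0 : 0 ≤ x) (h1 : x < 1) {k : ℕ} (hk : 0 < k) :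
    qProd c x = ∏ j ∈ Finset.range k, qProd (c * x ^ j) (x ^ k) := by
  refine tendsto_nhds_unique ((tendsto_qProd c h0 h1).comp (tendsto_id.const_mul_atTop' hk)) ?_
  refine (tendsto_finsetProd _ fun j _ ↦ tendsto_qProd (c * x ^ j) (pow_nonneg h0 k)
    (pow_lt_one₀ h0 h1 hk.ne')).congr fun N ↦ ?_
  simp only [Function.comp, id]
  rw [prod_range_mul_eq_prod_prod]
  exact Finset.prod_congr rfl fun j _ ↦ Finset.prod_congr rfl fun n _ ↦ by
    rw [← pow_mul, mul_assoc, ← pow_add, add_comm j]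

/-- Positive partial products only give a nonnegative limit; that it is nonzero comes from
summability of the perturbations. -/
lemma qProd_neg_self_pos {x : ℝ} (h0 : 0 ≤ x) (h1 : x < 1) : 0 < qProd (-x) x := by
  have hlt (n : ℕ) : 0 < 1 + -x * x ^ n := by
    have : x * x ^ n ≤ x * 1 := by gcongr; exact pow_le_one₀ h0 h1.le
    linarith
  refine lt_of_le_of_ne (ge_of_tendsto' (tendsto_qProd (-x) h0 h1) fun N ↦
    Finset.prod_nonneg fun n _ ↦ (hlt n).le) (Ne.symm ?_)
  exact tprod_one_add_ne_zero_of_summable (fun n ↦ (hlt n).ne')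
    (summable_norm_const_mul_pow (-x) h0 h1)

/-! ### Finite q-factorials and their reciprocals. -/

/-- The finite product `(1 - x) (1 - x ^ 2) ⋯ (1 - x ^ n)`. -/
noncomputable def qFactorial (x : ℝ) (n : ℕ) : ℝ := ∏ i ∈ Finset.range n, (1 + -x * x ^ i)

/-- The reciprocal of `qFactorial`, extended by zero to negative integers. -/
noncomputable def qFactorialInv (x : ℝ) (k : ℤ) : ℝ :=
  if k < 0 then 0 else (qFactorial x k.toNat)⁻¹

lemma qFactorial_factor_pos {x : ℝ} (h0 : 0 ≤ x) (h1 : x < 1) (n : ℕ) : 0 < 1 + -x * x ^ n := by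
  have : x * x ^ n ≤ x * 1 := by gcongr; exact pow_le_one₀ h0 h1.le
  linarith

lemma qFactorial_pos {x : ℝ} (h0 : 0 ≤ x) (h1 : x < 1) (n : ℕ) : 0 < qFactorial x n :=
  Finset.prod_pos fun i _ ↦ qFactorial_factor_pos h0 h1 i

lemma antitone_qFactorial {x : ℝ} (h0 : 0 ≤ x) (h1 : x < 1) : Antitone (qFactorial x) := by
  refine antitone_nat_of_succ_le fun n ↦ ?_
  rw [qFactorial, Finset.prod_range_succ]
  refine mul_le_of_le_one_right (qFactorial_pos h0 h1 n).le ?_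
  have : 0 ≤ x * x ^ n := by positivity
  linarith

lemma qProd_le_qFactorial {x : ℝ} (h0 : 0 ≤ x) (h1 : x < 1) (n : ℕ) :
    qProd (-x) x ≤ qFactorial x n :=
  (antitone_qFactorial h0 h1).le_of_tendsto (tendsto_qProd (-x) h0 h1) n

lemma qFactorial_le_one {x : ℝ} (h0 : 0 ≤ x) (h1 : x < 1) (n : ℕ) : qFactorial x n ≤ 1 := by
  simpa [qFactorial] using antitone_qFactorial h0 h1 (Nat.zero_le n)

lemma qFactorialInv_nonneg {x : ℝ} (h0 : 0 ≤ x) (h1 : x < 1) (k : ℤ) :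
    0 ≤ qFactorialInv x k := by
  unfold qFactorialInv
  split_ifs
  · exact le_rfl
  · exact (inv_pos.2 (qFactorial_pos h0 h1 _)).le

lemma qFactorialInv_le {x : ℝ} (h0 : 0 ≤ x) (h1 : x < 1) (k : ℤ) :
    qFactorialInv x k ≤ (qProd (-x) x)⁻¹ := by
  unfold qFactorialInv
  split_ifs
  · exact (inv_pos.2 (qProd_neg_self_pos h0 h1)).le
  · exact inv_anti₀ (qProd_neg_self_pos h0 h1) (qProd_le_qFactorial h0 h1 _)

/-- The extension by zero is consistent with the recurrence because the factor 1 - x ^ 0 vanishes at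
k = -1. No boundary cases are then needed in the triple product. -/
lemma qFactorialInv_eq {x : ℝ} (h0 : 0 ≤ x) (h1 : x < 1) (k : ℤ) :
    qFactorialInv x k = qFactorialInv x (k + 1) * (1 - x ^ (k + 1)) := by
  unfold qFactorialInv
  rcases lt_trichotomy k (-1) with h | rfl | h
  · rw [if_pos (by omega), if_pos (by omega), zero_mul]
  · simp
  · obtain ⟨n, rfl⟩ := Int.eq_ofNat_of_zero_le (show 0 ≤ k by omega)
    rw [if_neg (by omega), if_neg (by omega)]
    have e : ((n : ℤ) + 1).toNat = n + 1 := by omega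
    have e' : x ^ ((n : ℤ) + 1) = x ^ (n + 1) := by exact_mod_cast zpow_natCast x (n + 1)
    have hf := (qFactorial_factor_pos h0 h1 n).ne'
    have hp := (qFactorial_pos h0 h1 n).ne'
    rw [e, e', Int.toNat_natCast, qFactorial, qFactorial, Finset.prod_range_succ, ← qFactorial,
      mul_inv, mul_assoc, show 1 - x ^ (n + 1) = 1 + -x * x ^ n by ring, inv_mul_cancel₀ hf,
      mul_one]

lemma tendsto_qFactorialInv {x : ℝ} (h0 : 0 ≤ x) (h1 : x < 1) :
    Tendsto (qFactorialInv x) atTop (𝓝 (qProd (-x) x)⁻¹) := by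
  have ht : Tendsto Int.toNat atTop atTop :=
    tendsto_atTop.2 fun n ↦ (eventually_ge_atTop (n : ℤ)).mono fun k hk ↦ by omega
  refine (((tendsto_qProd (-x) h0 h1).comp ht).inv₀ (qProd_neg_self_pos h0 h1).ne').congr' ?_
  filter_upwards [eventually_ge_atTop 0] with k hk
  rw [qFactorialInv, if_neg (by omega)]
  rfl

/-! ### The Jacobi triple product. -/

/-- The theta series `∑_{k ∈ ℤ} p ^ (k ^ 2) z ^ k`. -/
noncomputable def thetaSum (p z : ℝ) : ℝ := ∑' k : ℤ, p ^ (k ^ 2) * z ^ k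

/-- The absolute values of the terms are the norms of the terms of `jacobiTheta₂` at τ = -i log p /
π and argument -i log |z| / (2π). -/
lemma summable_thetaSum {p : ℝ} (hp0 : 0 < p) (hp1 : p < 1) {z : ℝ} (hz : z ≠ 0) :
    Summable fun k : ℤ ↦ p ^ (k ^ 2) * z ^ k := by
  have hz' : 0 < |z| := abs_pos.2 hz
  have hτ : 0 < (Complex.I * ((-Real.log p / Real.pi : ℝ) : ℂ)).im := by
    simp only [Complex.mul_im, Complex.I_re, Complex.I_im, Complex.ofReal_re, Complex.ofReal_im,
      zero_mul, one_mul, zero_add]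
    exact div_pos (neg_pos.2 (Real.log_neg hp0 hp1)) Real.pi_pos
  have := ((summable_jacobiTheta₂_term_iff
    (Complex.I * ((-Real.log |z| / (2 * Real.pi) : ℝ) : ℂ)) _).2 hτ).norm
  refine (this.congr fun k ↦ ?_).of_norm
  rw [norm_jacobiTheta₂_term, norm_mul, norm_zpow, norm_zpow, Real.norm_of_nonneg hp0.le,
    Real.norm_eq_abs, ← Real.rpow_intCast, ← Real.rpow_intCast, Real.rpow_def_of_pos hp0,
    Real.rpow_def_of_pos hz', ← Real.exp_add]
  congr 1
  simp only [Complex.mul_im, Complex.I_re, Complex.I_im, Complex.ofReal_re, Complex.ofReal_im,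
      zero_mul, one_mul, zero_add]
  push_cast
  field_simp
  ring

/-- The finite form of the Jacobi triple product. -/
lemma hasSum_finite_triple_product {p : ℝ} (hp0 : 0 < p) (hp1 : p < 1) {z : ℝ} (hz : z ≠ 0)
    (N : ℕ) :
    HasSum (fun k : ℤ ↦ qFactorial (p ^ 2) (2 * N) * qFactorialInv (p ^ 2) (N + k) *
      qFactorialInv (p ^ 2) (N - k) * (p ^ (k ^ 2) * z ^ k))
      (∏ n ∈ Finset.range N, ((1 + z * p * (p ^ 2) ^ n) * (1 + p / z * (p ^ 2) ^ n))) := by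
  have hx0 : 0 ≤ p ^ 2 := sq_nonneg p
  have hx1 : p ^ 2 < 1 := pow_lt_one₀ hp0.le hp1 two_ne_zero
  induction N with
  | zero =>
    convert hasSum_single (0 : ℤ) ?_ using 1
    · simp [qFactorial, qFactorialInv]
    · intro k hk
      rcases lt_or_gt_of_ne hk with h | h
      · simp [qFactorialInv, h]
      · simp [qFactorialInv, h]
  | succ N ih =>
    rw [Finset.prod_range_succ]
    set F : ℤ → ℝ := fun k ↦ qFactorial (p ^ 2) (2 * N) * qFactorialInv (p ^ 2) (N + k) *
      qFactorialInv (p ^ 2) (N - k) * (p ^ (k ^ 2) * z ^ k) with hF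
    -- The new factor expands into a constant, a multiple of z and a multiple of 1/z. The last two
    -- act on the series by shifting k, which does not change the sum.
    have hm : HasSum (F ∘ Equiv.subRight (1 : ℤ)) _ := (Equiv.hasSum_iff _).2 ih
    have hp : HasSum (F ∘ Equiv.addRight (1 : ℤ)) _ := (Equiv.hasSum_iff _).2 ih
    have key := ((ih.mul_left (1 + p ^ (4 * N + 2))).add (hm.mul_left (p ^ (2 * N + 1) * z))).add
      (hp.mul_left (p ^ (2 * N + 1) / z))
    have hval : ∀ P : ℝ, P * ((1 + z * p * (p ^ 2) ^ N) * (1 + p / z * (p ^ 2) ^ N)) =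
        (1 + p ^ (4 * N + 2)) * P + p ^ (2 * N + 1) * z * P + p ^ (2 * N + 1) / z * P := by
      intro P
      field_simp
      ring
    rw [hval]
    convert! key using 2 with k
    simp only [hF, Function.comp, Equiv.coe_addRight, Equiv.subRight_apply]
    set x := p ^ 2 with hx
    have hxne : x ≠ 0 := by positivity
    set H := qFactorialInv x (N + 1 + k) with hH
    set H' := qFactorialInv x (N + 1 - k) with hH'
    set u := x ^ ((N : ℤ) + 1 + k) with hu
    set v := x ^ ((N : ℤ) + 1 - k) with hv
    have step {j j' : ℤ} (h : j + 1 = j') :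
        qFactorialInv x j = qFactorialInv x j' * (1 - x ^ j') := by
      rw [← h, qFactorialInv_eq hx0 hx1]
    have e1 : qFactorialInv x (N + k) = H * (1 - u) := step (by ring)
    have e2 : qFactorialInv x (N - k) = H' * (1 - v) := step (by ring)
    have e3 : qFactorialInv x (N + (k - 1)) = H * (1 - u) * (1 - u / x) := by
      rw [step (j' := N + k) (by ring), e1, hu, div_eq_mul_inv, ← zpow_sub_one₀ hxne,
        show (N : ℤ) + 1 + k - 1 = N + k by ring]
    have e4 : qFactorialInv x (N - (k + 1)) = H' * (1 - v) * (1 - v / x) := by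
      rw [step (j' := N - k) (by ring), e2, hv, div_eq_mul_inv, ← zpow_sub_one₀ hxne,
        show (N : ℤ) + 1 - k - 1 = N - k by ring]
    have e5 : qFactorialInv x (N - (k - 1)) = H' := by rw [hH']; congr 1; ring
    have e6 : qFactorialInv x (N + (k + 1)) = H := by rw [hH]; congr 1; ring
    have e7 : qFactorialInv x (((N + 1 : ℕ) : ℤ) + k) = H := by rw [hH]; push_cast; rfl
    have e8 : qFactorialInv x (((N + 1 : ℕ) : ℤ) - k) = H' := by rw [hH']; push_cast; rfl
    have huv : u * v = x ^ (2 * N + 2) := by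
      rw [hu, hv, ← zpow_add₀ hxne, ← zpow_natCast]; congr 1; push_cast; ring
    have e9 : qFactorial x (2 * (N + 1)) = qFactorial x (2 * N) * (1 - u * v / x) * (1 - u * v) := by
      rw [huv, show 2 * (N + 1) = 2 * N + 1 + 1 by ring, qFactorial, Finset.prod_range_succ,
        Finset.prod_range_succ, ← qFactorial]
      field_simp
      ring
    have e10 : p ^ (4 * N + 2) = u * v / x := by
      rw [huv, hx]; field_simp; ring
    have e11 : p ^ (2 * N + 1) * z * (p ^ ((k - 1) ^ 2) * z ^ (k - 1)) =
        v * (p ^ (k ^ 2) * z ^ k) := by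
      rw [zpow_sub_one₀ hz, hv, hx, ← zpow_natCast p 2, ← zpow_mul, ← zpow_natCast]
      have : p ^ ((2 * N + 1 : ℕ) : ℤ) * p ^ ((k - 1) ^ 2) =
          p ^ (((2 : ℕ) : ℤ) * (N + 1 - k)) * p ^ (k ^ 2) := by
        rw [← zpow_add₀ hp0.ne', ← zpow_add₀ hp0.ne']; congr 1; push_cast; ring
      field_simp
      linear_combination this
    have e12 : p ^ (2 * N + 1) / z * (p ^ ((k + 1) ^ 2) * z ^ (k + 1)) =
        u * (p ^ (k ^ 2) * z ^ k) := by
      rw [zpow_add_one₀ hz, hu, hx, ← zpow_natCast p 2, ← zpow_mul, ← zpow_natCast]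
      have : p ^ ((2 * N + 1 : ℕ) : ℤ) * p ^ ((k + 1) ^ 2) =
          p ^ (((2 : ℕ) : ℤ) * (N + 1 + k)) * p ^ (k ^ 2) := by
        rw [← zpow_add₀ hp0.ne', ← zpow_add₀ hp0.ne']; congr 1; push_cast; ring
      field_simp
      linear_combination this
    rw [e1, e2, e3, e4, e5, e6, e7, e8, e9, e10]
    set W := p ^ (k ^ 2) * z ^ k
    set G := qFactorial x (2 * N)
    -- With both q-factorials normalised to index N + 1, the recurrence for the coefficients reduces
    -- to this rational identity in u, v and x.
    have hid : (1 - u * v / x) * (1 - u * v) = (1 + u * v / x) * (1 - u) * (1 - v) +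
        v * (1 - u) * (1 - u / x) + u * (1 - v) * (1 - v / x) := by ring
    linear_combination G * H * H' * W * hid -
      G * H * (1 - u) * (1 - u / x) * H' * e11 - G * H * H' * (1 - v) * (1 - v / x) * e12

/-- The Jacobi triple product. -/
theorem thetaSum_eq_qProd {p : ℝ} (hp0 : 0 < p) (hp1 : p < 1) {z : ℝ} (hz : z ≠ 0) :
    thetaSum p z = qProd (-p ^ 2) (p ^ 2) * qProd (z * p) (p ^ 2) * qProd (p / z) (p ^ 2) := by
  have hx0 : 0 ≤ p ^ 2 := sq_nonneg p
  have hx1 : p ^ 2 < 1 := pow_lt_one₀ hp0.le hp1 two_ne_zero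
  set E := qProd (-p ^ 2) (p ^ 2) with hE
  have hEpos : 0 < E := qProd_neg_self_pos hx0 hx1
  have hlim : Tendsto (fun N : ℕ ↦ ∑' k : ℤ, qFactorial (p ^ 2) (2 * N) *
      qFactorialInv (p ^ 2) (N + k) * qFactorialInv (p ^ 2) (N - k) * (p ^ (k ^ 2) * z ^ k)) atTop
      (𝓝 (∑' k : ℤ, E * E⁻¹ * E⁻¹ * (p ^ (k ^ 2) * z ^ k))) := by
    refine tendsto_tsum_of_dominated_convergence
      (bound := fun k ↦ 1 * E⁻¹ * E⁻¹ * ‖p ^ (k ^ 2) * z ^ k‖)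
      ((summable_thetaSum hp0 hp1 hz).norm.mul_left _) (fun k ↦ ?_) (.of_forall fun N k ↦ ?_)
    · refine Tendsto.mul_const _ (.mul (.mul ?_ ?_) ?_)
      · exact (tendsto_qProd _ hx0 hx1).comp (tendsto_id.const_mul_atTop' two_pos)
      · exact (tendsto_qFactorialInv hx0 hx1).comp
          (tendsto_atTop_add_const_right _ _ tendsto_natCast_atTop_atTop)
      · exact (tendsto_qFactorialInv hx0 hx1).comp
          (tendsto_atTop_add_const_right _ _ tendsto_natCast_atTop_atTop)
    · have a1 := qFactorialInv_nonneg hx0 hx1 (N + k)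
      have a2 := qFactorialInv_nonneg hx0 hx1 (N - k)
      have a3 := (qFactorial_pos hx0 hx1 (2 * N)).le
      rw [norm_mul, Real.norm_of_nonneg (by positivity)]
      gcongr
      · exact qFactorial_le_one hx0 hx1 _
      · exact qFactorialInv_le hx0 hx1 _
      · exact qFactorialInv_le hx0 hx1 _
  simp_rw [fun N ↦ (hasSum_finite_triple_product hp0 hp1 hz N).tsum_eq,
    Finset.prod_mul_distrib] at hlim
  have := tendsto_nhds_unique hlim
    ((tendsto_qProd (z * p) hx0 hx1).mul (tendsto_qProd (p / z) hx0 hx1))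
  rw [tsum_mul_left, ← thetaSum, mul_inv_cancel₀ hEpos.ne', one_mul] at this
  rw [mul_assoc, ← this, mul_inv_cancel_left₀ hEpos.ne']

/-! ### Theta values as Euler products. -/

/-- Euler's product `∏_{n ≥ 1} (1 - x ^ n)`. -/
noncomputable def eulerProd (x : ℝ) : ℝ := qProd (-x) x

lemma eulerProd_pos {x : ℝ} (h0 : 0 ≤ x) (h1 : x < 1) : 0 < eulerProd x :=
  qProd_neg_self_pos h0 h1

lemma qProd_self_mul_eulerProd {x : ℝ} (h0 : 0 ≤ x) (h1 : x < 1) :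
    qProd x x * eulerProd x = eulerProd (x ^ 2) :=
  qProd_mul_neg x h0 h1

lemma qProd_neg_sq_mul_eulerProd {x : ℝ} (h0 : 0 ≤ x) (h1 : x < 1) :
    qProd (-x) (x ^ 2) * eulerProd (x ^ 2) = eulerProd x := by
  rw [eulerProd, eulerProd, qProd_eq_prod (-x) h0 h1 Nat.zero_lt_two]
  rw [Finset.prod_range_succ, Finset.prod_range_one, pow_zero, pow_one, mul_one]
  ring_nf

lemma qProd_sq_mul_qProd {x : ℝ} (h0 : 0 ≤ x) (h1 : x < 1) :
    qProd x (x ^ 2) * qProd (x ^ 2) (x ^ 2) = qProd x x := by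
  rw [qProd_eq_prod x h0 h1 (Nat.zero_lt_two)]
  rw [Finset.prod_range_succ, Finset.prod_range_one, pow_zero, pow_one, mul_one]
  ring_nf

lemma thetaSum_neg_one_mul {p : ℝ} (hp0 : 0 < p) (hp1 : p < 1) :
    thetaSum p (-1) * eulerProd (p ^ 2) = eulerProd p ^ 2 := by
  rw [thetaSum_eq_qProd hp0 hp1 (by norm_num), ← eulerProd,
    ← qProd_neg_sq_mul_eulerProd hp0.le hp1, neg_one_mul, div_neg, div_one]
  ring

/-- At z = p the last product in the triple product starts with 1 + 1, which is the origin of the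
factor 2. -/
lemma thetaSum_self_mul {p : ℝ} (hp0 : 0 < p) (hp1 : p < 1) :
    thetaSum p p * eulerProd (p ^ 2) = 2 * eulerProd (p ^ 4) ^ 2 := by
  have hx0 : 0 ≤ p ^ 2 := sq_nonneg p
  have hx1 : p ^ 2 < 1 := pow_lt_one₀ hp0.le hp1 two_ne_zero
  have h := qProd_self_mul_eulerProd hx0 hx1
  rw [← pow_mul] at h
  rw [thetaSum_eq_qProd hp0 hp1 hp0.ne', ← eulerProd, div_self hp0.ne', qProd_eq_mul 1 hx0 hx1,
    one_mul, ← sq p, ← h]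
  ring

lemma thetaSum_one_mul {p : ℝ} (hp0 : 0 < p) (hp1 : p < 1) :
    thetaSum p 1 * (eulerProd p ^ 2 * eulerProd (p ^ 4) ^ 2) = eulerProd (p ^ 2) ^ 5 := by
  have hx0 : 0 ≤ p ^ 2 := sq_nonneg p
  have hx1 : p ^ 2 < 1 := pow_lt_one₀ hp0.le hp1 two_ne_zero
  have h := qProd_self_mul_eulerProd hx0 hx1
  have h' := qProd_self_mul_eulerProd hp0.le hp1
  rw [← qProd_sq_mul_qProd hp0.le hp1] at h'
  rw [← pow_mul] at h
  rw [thetaSum_eq_qProd hp0 hp1 one_ne_zero, ← eulerProd, one_mul, div_one, ← h]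
  linear_combination (eulerProd (p ^ 2)) ^ 3 * (qProd p (p ^ 2) * qProd (p ^ 2) (p ^ 2) *
    eulerProd p + eulerProd (p ^ 2)) * h'

/-- The two triple products contribute 1 + p ^ (2n) for all n ≥ 1 prime to five; the missing
multiples of five form `qProd (p ^ 10) (p ^ 10)`. -/
lemma thetaSum_pow_five_mul {p : ℝ} (hp0 : 0 < p) (hp1 : p < 1) :
    thetaSum (p ^ 5) (p ^ 3) * thetaSum (p ^ 5) p * (eulerProd (p ^ 2) * eulerProd (p ^ 20)) =
      eulerProd (p ^ 4) * eulerProd (p ^ 10) ^ 3 := by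
  have hx0 : 0 ≤ p ^ 2 := sq_nonneg p
  have hx1 : p ^ 2 < 1 := pow_lt_one₀ hp0.le hp1 two_ne_zero
  have hy0 : 0 ≤ p ^ 10 := by positivity
  have hy1 : p ^ 10 < 1 := pow_lt_one₀ hp0.le hp1 (by norm_num)
  have h := qProd_self_mul_eulerProd hx0 hx1
  have h' := qProd_self_mul_eulerProd hy0 hy1
  have h5 := qProd_eq_prod (p ^ 2) hx0 hx1 (show 0 < 5 by norm_num)
  simp only [Finset.prod_range_succ, Finset.prod_range_zero, one_mul, ← pow_mul, ← pow_add,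
    mul_one] at h h' h5
  norm_num at h h' h5
  rw [h5] at h
  rw [thetaSum_eq_qProd (pow_pos hp0 5) (pow_lt_one₀ hp0.le hp1 (by norm_num))
      (pow_ne_zero 3 hp0.ne'),
    thetaSum_eq_qProd (pow_pos hp0 5) (pow_lt_one₀ hp0.le hp1 (by norm_num)) hp0.ne',
    show p ^ 5 / p ^ 3 = p ^ 2 by field_simp, show p ^ 5 / p = p ^ 4 by field_simp,
    show p ^ 3 * p ^ 5 = p ^ 8 by ring, show p * p ^ 5 = p ^ 6 by ring, ← pow_mul,
    show 5 * 2 = 10 by norm_num, ← eulerProd, ← h', ← h]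
  ring

/-! ### Double theta series and coset decompositions of ℤ × ℤ. -/

lemma tsum_eq_sum_tsum_comp {ι α β : Type*} [Fintype ι] (e : ι → β → α)
    (he : Function.Bijective fun x : ι × β ↦ e x.1 x.2) {f : α → ℝ} (hf : Summable f) :
    ∑' a, f a = ∑ i, ∑' b, f (e i b) := by
  rw [← (Equiv.ofBijective _ he).tsum_eq f,
    Summable.tsum_prod (f := fun x ↦ f (Equiv.ofBijective _ he x))
      ((Equiv.ofBijective _ he).summable_iff.2 hf), tsum_fintype]
  rfl

/-- The general term of a product of two theta series. -/
noncomputable def thetaTerm (p z q w : ℝ) (x : ℤ × ℤ) : ℝ :=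
  p ^ (x.1 ^ 2) * z ^ x.1 * (q ^ (x.2 ^ 2) * w ^ x.2)

section

variable {p z q w : ℝ}

lemma summable_thetaTerm (hp0 : 0 < p) (hp1 : p < 1) (hz : z ≠ 0) (hq0 : 0 < q) (hq1 : q < 1)
    (hw : w ≠ 0) : Summable (thetaTerm p z q w) :=
  summable_mul_of_summable_norm (summable_thetaSum hp0 hp1 hz).norm
    (summable_thetaSum hq0 hq1 hw).norm

lemma thetaSum_mul_thetaSum (hp0 : 0 < p) (hp1 : p < 1) (hz : z ≠ 0) (hq0 : 0 < q) (hq1 : q < 1)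
    (hw : w ≠ 0) : thetaSum p z * thetaSum q w = ∑' x, thetaTerm p z q w x :=
  tsum_mul_tsum_of_summable_norm (summable_thetaSum hp0 hp1 hz).norm
    (summable_thetaSum hq0 hq1 hw).norm

lemma thetaTerm_pow (hp : p ≠ 0) (a b c d : ℕ) (x : ℤ × ℤ) :
    thetaTerm (p ^ a) (p ^ b) (p ^ c) (p ^ d) x =
      p ^ (a * x.1 ^ 2 + b * x.1 + c * x.2 ^ 2 + d * x.2) := by
  simp only [thetaTerm, ← zpow_natCast p, ← zpow_mul, ← zpow_add₀ hp]
  congr 1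
  ring

end

/-- The two cosets of the index two sublattice of `ℤ × ℤ` of vectors with even coordinate sum. -/
def parityMap (i : Fin 2) (x : ℤ × ℤ) : ℤ × ℤ := (x.1 + x.2 + i.val, x.1 - x.2)

lemma bijective_parityMap :
    Function.Bijective fun x : Fin 2 × (ℤ × ℤ) ↦ parityMap x.1 x.2 := by
  constructor
  · rintro ⟨i, k, l⟩ ⟨i', k', l'⟩ h
    simp only [parityMap, Prod.mk.injEq] at h ⊢
    omega
  · rintro ⟨m, n⟩
    refine ⟨(⟨((m + n) % 2).toNat, by omega⟩, ((m + n) / 2, (m + n) / 2 - n)), ?_⟩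
    simp only [parityMap, Prod.mk.injEq]
    omega

/-- The two residue classes of `x.1 - x.2` modulo two, each parametrised by `ℤ × ℤ`. -/
def hexMap (i : Fin 2) (x : ℤ × ℤ) : ℤ × ℤ :=
  (2 * x.1 - x.2, if i = 0 then x.2 else -1 - x.2)

lemma bijective_hexMap : Function.Bijective fun x : Fin 2 × (ℤ × ℤ) ↦ hexMap x.1 x.2 := by
  constructor
  · rintro ⟨i, k, l⟩ ⟨i', k', l'⟩ h
    fin_cases i <;> fin_cases i' <;> simp [hexMap, Prod.mk.injEq] at h ⊢ <;> omega
  · rintro ⟨m, n⟩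
    rcases Int.emod_two_eq_zero_or_one (m + n) with h | h
    · refine ⟨(0, ((m + n) / 2, n)), ?_⟩
      simp [hexMap]
      omega
    · refine ⟨(1, ((m - n) / 2, -1 - n)), ?_⟩
      simp [hexMap]
      omega

/-- The five cosets of the index five sublattice of `ℤ × ℤ` of vectors `x` with
`x.1 ≡ 2 x.2` modulo five. -/
def quintMap (i : Fin 5) (x : ℤ × ℤ) : ℤ × ℤ :=
  ![(2 * x.1 - x.2, x.1 + 2 * x.2 + 1), (2 * x.1 - x.2, x.1 + 2 * x.2),
    (-1 - (2 * x.1 - x.2), -1 - (x.1 + 2 * x.2)), (-1 - (x.1 + 2 * x.2), 2 * x.1 - x.2),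
    (x.1 + 2 * x.2, -1 - (2 * x.1 - x.2))] i

lemma bijective_quintMap : Function.Bijective fun x : Fin 5 × (ℤ × ℤ) ↦ quintMap x.1 x.2 := by
  constructor
  · rintro ⟨i, k, l⟩ ⟨i', k', l'⟩ h
    fin_cases i <;> fin_cases i' <;> simp [quintMap, Prod.mk.injEq] at h ⊢ <;> omega
  · rintro ⟨m, n⟩
    have h : (m - 2 * n) % 5 = 0 ∨ (m - 2 * n) % 5 = 1 ∨ (m - 2 * n) % 5 = 2 ∨
      (m - 2 * n) % 5 = 3 ∨ (m - 2 * n) % 5 = 4 := by omega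
    rcases h with h | h | h | h | h
    · refine ⟨(1, ((2 * m + n) / 5, (2 * n - m) / 5)), ?_⟩
      simp [quintMap]
      omega
    · refine ⟨(2, ((2 * (-1 - m) + (-1 - n)) / 5, (2 * (-1 - n) - (-1 - m)) / 5)), ?_⟩
      simp [quintMap]
      omega
    · refine ⟨(4, ((2 * (-1 - n) + m) / 5, (2 * m - (-1 - n)) / 5)), ?_⟩
      simp [quintMap]
      omega
    · refine ⟨(0, ((2 * m + (n - 1)) / 5, (2 * (n - 1) - m) / 5)), ?_⟩
      simp [quintMap]
      omega
    · refine ⟨(3, ((2 * n + (-1 - m)) / 5, (2 * (-1 - m) - n) / 5)), ?_⟩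
      simp [quintMap]
      omega

/-! ### Theta identities of degree two, three and five. -/

lemma thetaTerm_neg_one {p q : ℝ} (x : ℤ × ℤ) :
    thetaTerm p (-1) q (-1) x = (-1) ^ (x.1 + x.2) * thetaTerm p 1 q 1 x := by
  simp only [thetaTerm, one_zpow, mul_one, zpow_add₀ (show (-1 : ℝ) ≠ 0 by norm_num)]
  ring

lemma thetaSum_one_sq {p : ℝ} (hp0 : 0 < p) (hp1 : p < 1) :
    thetaSum p 1 ^ 2 = thetaSum (p ^ 2) 1 ^ 2 + p * thetaSum (p ^ 2) (p ^ 2) ^ 2 := by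
  have hx0 : 0 < p ^ 2 := pow_pos hp0 2
  have hx1 : p ^ 2 < 1 := pow_lt_one₀ hp0.le hp1 two_ne_zero
  simp only [sq (thetaSum _ _)]
  rw [thetaSum_mul_thetaSum hp0 hp1 one_ne_zero hp0 hp1 one_ne_zero,
    thetaSum_mul_thetaSum hx0 hx1 one_ne_zero hx0 hx1 one_ne_zero,
    thetaSum_mul_thetaSum hx0 hx1 hx0.ne' hx0 hx1 hx0.ne',
    tsum_eq_sum_tsum_comp _ bijective_parityMap
      (summable_thetaTerm hp0 hp1 one_ne_zero hp0 hp1 one_ne_zero), Fin.sum_univ_two,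
    ← tsum_mul_left]
  have e1 := thetaTerm_pow hp0.ne' 1 0 1 0
  have e2 := thetaTerm_pow hp0.ne' 2 0 2 0
  have e3 := thetaTerm_pow hp0.ne' 2 2 2 2
  simp only [pow_one, pow_zero] at e1 e2 e3
  simp only [e1, e2, e3, ← zpow_one_add₀ hp0.ne']
  congr 1 <;> refine tsum_congr fun x ↦ ?_ <;> congr 1 <;> simp [parityMap] <;> ring

/-- The sign (-1) ^ (m + n) is constant on each coset, so θ₄ products differ from θ₃ products only
in the sign of the odd coset. -/
lemma thetaTerm_neg_one_parityMap {p q : ℝ} (i : Fin 2) (x : ℤ × ℤ) :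
    thetaTerm p (-1) q (-1) (parityMap i x) =
      (-1) ^ i.val * thetaTerm p 1 q 1 (parityMap i x) := by
  rw [thetaTerm_neg_one]
  congr 1
  have : (parityMap i x).1 + (parityMap i x).2 = 2 * x.1 + i.val := by
    simp only [parityMap]
    ring
  rw [this, zpow_add₀ (by norm_num), zpow_mul, zpow_natCast]
  norm_num

lemma thetaSum_neg_one_sq {p : ℝ} (hp0 : 0 < p) (hp1 : p < 1) :
    thetaSum p (-1) ^ 2 = thetaSum (p ^ 2) 1 ^ 2 - p * thetaSum (p ^ 2) (p ^ 2) ^ 2 := by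
  have hx0 : 0 < p ^ 2 := pow_pos hp0 2
  have hx1 : p ^ 2 < 1 := pow_lt_one₀ hp0.le hp1 two_ne_zero
  have hn : (-1 : ℝ) ≠ 0 := by norm_num
  simp only [sq (thetaSum _ _)]
  rw [thetaSum_mul_thetaSum hp0 hp1 hn hp0 hp1 hn,
    thetaSum_mul_thetaSum hx0 hx1 one_ne_zero hx0 hx1 one_ne_zero,
    thetaSum_mul_thetaSum hx0 hx1 hx0.ne' hx0 hx1 hx0.ne',
    tsum_eq_sum_tsum_comp _ bijective_parityMap
      (summable_thetaTerm hp0 hp1 hn hp0 hp1 hn), Fin.sum_univ_two, sub_eq_add_neg,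
    ← tsum_mul_left, ← tsum_neg]
  have e1 := thetaTerm_pow hp0.ne' 1 0 1 0
  have e2 := thetaTerm_pow hp0.ne' 2 0 2 0
  have e3 := thetaTerm_pow hp0.ne' 2 2 2 2
  simp only [pow_one, pow_zero] at e1 e2 e3
  simp only [thetaTerm_neg_one_parityMap, e1, e2, e3, ← zpow_one_add₀ hp0.ne', Fin.val_zero,
    Fin.val_one, pow_zero, pow_one, one_mul, neg_one_mul]
  congr 1 <;> refine tsum_congr fun x ↦ ?_
  · congr 1
    simp [parityMap]
    ring
  · congr 2
    simp [parityMap]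
    ring

/-- Jacobi's quartic identity `θ₃ ^ 4 = θ₂ ^ 4 + θ₄ ^ 4`. -/
theorem thetaSum_one_pow_four {p : ℝ} (hp0 : 0 < p) (hp1 : p < 1) :
    thetaSum p 1 ^ 4 = p * thetaSum p p ^ 4 + thetaSum p (-1) ^ 4 := by
  have hx0 : 0 < p ^ 2 := pow_pos hp0 2
  have hx1 : p ^ 2 < 1 := pow_lt_one₀ hp0.le hp1 two_ne_zero
  have pos {n : ℕ} (hn : n ≠ 0) : 0 < eulerProd (p ^ n) :=
    eulerProd_pos (pow_nonneg hp0.le n) (pow_lt_one₀ hp0.le hp1 hn)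
  have h2 := pos two_ne_zero
  have h4 := pos four_ne_zero
  have h8 := pos (n := 8) (by norm_num)
  have landen : thetaSum p p ^ 2 = 2 * thetaSum (p ^ 2) (p ^ 2) * thetaSum (p ^ 2) 1 := by
    have e1 := thetaSum_self_mul hp0 hp1
    have e2 := thetaSum_self_mul hx0 hx1
    have e3 := thetaSum_one_mul hx0 hx1
    simp only [← pow_mul] at e2 e3
    norm_num at e2 e3
    rw [← eq_div_iff (by positivity)] at e1 e2 e3
    rw [e1, e2, e3]
    field_simp
  -- The difference θ₃² - θ₄² is 2pθ₂(p²)² and the sum is 2θ₃(p²)² (with θ₂ stripped of its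
  -- fractional power); `landen` identifies their product as pθ₂(p)⁴.
  linear_combination (thetaSum p 1 ^ 2 + thetaSum p (-1) ^ 2) *
      (thetaSum_one_sq hp0 hp1 - thetaSum_neg_one_sq hp0 hp1) +
    2 * p * thetaSum (p ^ 2) (p ^ 2) ^ 2 *
      (thetaSum_one_sq hp0 hp1 + thetaSum_neg_one_sq hp0 hp1) -
    p * (thetaSum p p ^ 2 + 2 * thetaSum (p ^ 2) (p ^ 2) * thetaSum (p ^ 2) 1) * landen

/-- The modular equation of degree three,
`θ₃(p) θ₃(p ^ 3) = θ₂(p) θ₂(p ^ 3) + θ₄(p) θ₄(p ^ 3)`. -/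
theorem thetaSum_degree_three {p : ℝ} (hp0 : 0 < p) (hp1 : p < 1) :
    thetaSum p 1 * thetaSum (p ^ 3) 1 = p * (thetaSum p p * thetaSum (p ^ 3) (p ^ 3)) +
      thetaSum p (-1) * thetaSum (p ^ 3) (-1) := by
  have hx0 : 0 < p ^ 3 := pow_pos hp0 3
  have hx1 : p ^ 3 < 1 := pow_lt_one₀ hp0.le hp1 three_ne_zero
  have hn : (-1 : ℝ) ≠ 0 := by norm_num
  rw [thetaSum_mul_thetaSum hp0 hp1 one_ne_zero hx0 hx1 one_ne_zero,
    thetaSum_mul_thetaSum hp0 hp1 hp0.ne' hx0 hx1 hx0.ne',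
    thetaSum_mul_thetaSum hp0 hp1 hn hx0 hx1 hn,
    tsum_eq_sum_tsum_comp _ bijective_parityMap
      (summable_thetaTerm hp0 hp1 one_ne_zero hx0 hx1 one_ne_zero),
    tsum_eq_sum_tsum_comp _ bijective_parityMap (summable_thetaTerm hp0 hp1 hn hx0 hx1 hn),
    tsum_eq_sum_tsum_comp _ bijective_hexMap
      (summable_thetaTerm hp0 hp1 hp0.ne' hx0 hx1 hx0.ne')]
  simp only [Fin.sum_univ_two, thetaTerm_neg_one_parityMap, Fin.val_zero,
    Fin.val_one, pow_zero, pow_one, one_mul, neg_one_mul, tsum_neg]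
  have e1 := thetaTerm_pow hp0.ne' 1 0 3 0
  have e2 := thetaTerm_pow hp0.ne' 1 1 3 3
  simp only [pow_one, pow_zero] at e1 e2
  -- The odd coset survives twice in θ₃θ₃ - θ₄θ₄; each copy matches one residue class of the θ₂
  -- product.
  have h (i : Fin 2) : ∑' x, thetaTerm p 1 (p ^ 3) 1 (parityMap 1 x) =
      p * ∑' x, thetaTerm p p (p ^ 3) (p ^ 3) (hexMap i x) := by
    rw [← tsum_mul_left]
    refine tsum_congr fun x ↦ ?_
    rw [e1, e2, ← zpow_one_add₀ hp0.ne']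
    congr 1
    fin_cases i <;> simp [parityMap, hexMap] <;> ring
  linear_combination h 0 + h 1

/-- A modular equation of degree five. -/
theorem thetaSum_degree_five {p : ℝ} (hp0 : 0 < p) (hp1 : p < 1) :
    thetaSum p p ^ 2 = p ^ 2 * thetaSum (p ^ 5) (p ^ 5) ^ 2 +
      4 * (thetaSum (p ^ 5) (p ^ 3) * thetaSum (p ^ 5) p) := by
  have hx0 : 0 < p ^ 5 := pow_pos hp0 5
  have hx1 : p ^ 5 < 1 := pow_lt_one₀ hp0.le hp1 (by norm_num)
  simp only [sq (thetaSum _ _)]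
  rw [thetaSum_mul_thetaSum hp0 hp1 hp0.ne' hp0 hp1 hp0.ne',
    thetaSum_mul_thetaSum hx0 hx1 hx0.ne' hx0 hx1 hx0.ne',
    thetaSum_mul_thetaSum hx0 hx1 (pow_ne_zero 3 hp0.ne') hx0 hx1 hp0.ne',
    tsum_eq_sum_tsum_comp _ bijective_quintMap
      (summable_thetaTerm hp0 hp1 hp0.ne' hp0 hp1 hp0.ne'), Fin.sum_univ_succ, ← tsum_mul_left]
  have e1 := thetaTerm_pow hp0.ne' 1 1 1 1
  have e2 := thetaTerm_pow hp0.ne' 5 5 5 5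
  have e3 := thetaTerm_pow hp0.ne' 5 3 5 1
  simp only [pow_one] at e1 e2 e3
  -- The form m² + m + n² + n is invariant under swapping coordinates and under m ↦ -1 - m. These
  -- symmetries relate four of the classes; the remaining one gives the p ^ 2 term.
  have h (i : Fin 4) : ∑' x, thetaTerm p p p p (quintMap i.succ x) =
      ∑' x, thetaTerm (p ^ 5) (p ^ 3) (p ^ 5) p x := by
    refine tsum_congr fun x ↦ ?_
    rw [e1, e3]
    congr 1
    fin_cases i <;> simp [quintMap] <;> ring
  simp only [h, Finset.sum_const, Finset.card_univ, Fintype.card_fin, nsmul_eq_mul]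
  congr 1
  refine tsum_congr fun x ↦ ?_
  rw [e1, e2, ← zpow_natCast p 2, ← zpow_add₀ hp0.ne']
  congr 1
  simp [quintMap]
  ring

/-! ### The eta function on the imaginary axis and its modular equations. -/

/-- The Dedekind eta function on the imaginary axis, as a real function:
`η(iy) = e ^ (-πy / 12) ∏_{n ≥ 1} (1 - e ^ (-2πny))`. -/
noncomputable def etaImag (y : ℝ) : ℝ :=
  Real.exp (-Real.pi * y / 12) * eulerProd (Real.exp (-Real.pi * y / 12) ^ 24)

lemma exp_neg_pi_mul_lt_one {y : ℝ} (hy : 0 < y) : Real.exp (-Real.pi * y / 12) < 1 := by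
  rw [Real.exp_lt_one_iff]
  have := mul_pos Real.pi_pos hy
  linarith

lemma etaImag_pos {y : ℝ} (hy : 0 < y) : 0 < etaImag y :=
  mul_pos (Real.exp_pos _) (eulerProd_pos (by positivity)
    (pow_lt_one₀ (Real.exp_pos _).le (exp_neg_pi_mul_lt_one hy) (by norm_num)))

lemma etaImag_natCast_mul (k : ℕ) (y : ℝ) :
    etaImag (k * y) = Real.exp (-Real.pi * y / 12) ^ k *
      eulerProd (Real.exp (-Real.pi * y / 12) ^ (24 * k)) := by
  have : Real.exp (-Real.pi * (k * y) / 12) = Real.exp (-Real.pi * y / 12) ^ k := by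
    rw [← Real.exp_nat_mul]
    congr 1
    ring
  rw [etaImag, this, ← pow_mul, mul_comm k]

/-- Negative x is allowed because q is negative on the line Re τ = 1/2. -/
lemma tprod_one_sub_pow_ofReal {x : ℝ} (h : |x| < 1) :
    ∏' n : ℕ, (1 - (x : ℂ) ^ (n + 1)) = ((∏' n : ℕ, (1 + -x * x ^ n) : ℝ) : ℂ) := by
  have hm : Multipliable fun n : ℕ ↦ 1 + -x * x ^ n := by
    refine multipliable_one_add_of_summable ?_
    simp_rw [norm_mul, norm_pow, Real.norm_eq_abs]
    exact (summable_geometric_of_lt_one (abs_nonneg x) h).mul_left _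
  rw [← Complex.ofRealHom_eq_coe (∏' n : ℕ, (1 + -x * x ^ n)),
    hm.map_tprod Complex.ofRealHom Complex.continuous_ofReal]
  refine tprod_congr fun n ↦ ?_
  simp only [Complex.ofRealHom_eq_coe]
  push_cast
  ring

lemma eta_I_mul {y : ℝ} (hy : 0 < y) : eta (Complex.I * y) = etaImag y := by
  have hq : Function.Periodic.qParam 1 (Complex.I * y) =
      ((Real.exp (-Real.pi * y / 12) ^ 24 : ℝ) : ℂ) := by
    rw [Function.Periodic.qParam, ← Real.exp_nat_mul]
    push_cast
    congr 1
    linear_combination (2 * Real.pi * y : ℂ) * Complex.I_sq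
  have hq' : Function.Periodic.qParam 24 (Complex.I * y) =
      ((Real.exp (-Real.pi * y / 12) : ℝ) : ℂ) := by
    rw [Function.Periodic.qParam]
    push_cast
    congr 1
    linear_combination (2 * Real.pi * y / 24 : ℂ) * Complex.I_sq
  have hlt := pow_lt_one₀ (Real.exp_pos _).le (exp_neg_pi_mul_lt_one hy) (n := 24) (by norm_num)
  rw [eta, hq']
  simp only [ModularForm.eta_q, hq]
  rw [tprod_one_sub_pow_ofReal (by rwa [abs_of_pos (by positivity)]), ← Complex.ofReal_mul]
  rfl

/-- The inversion formula for the eta function on the imaginary axis. -/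
lemma etaImag_inv_sq {y : ℝ} (hy : 0 < y) : etaImag y⁻¹ ^ 2 = y * etaImag y ^ 2 := by
  have h := ModularForm.eta_comp_eq_csqrt_I_inv
    (show Complex.I * y ∈ UpperHalfPlane.upperHalfPlaneSet by simpa using hy)
  have e : -1 / (Complex.I * y) = Complex.I * ((y⁻¹ : ℝ) : ℂ) := by
    have : (y : ℂ) ≠ 0 := by exact_mod_cast hy.ne'
    push_cast
    field_simp
    rw [Complex.I_sq]
  have norm_sqrt (z : ℂ) : ‖Complex.sqrt z‖ ^ 2 = ‖z‖ := by
    rw [Complex.sqrt, show (2⁻¹ : ℂ) = ((2 : ℕ) : ℂ)⁻¹ by norm_num, Complex.norm_cpow_inv_nat,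
      ← Real.rpow_natCast, ← Real.rpow_mul (norm_nonneg z)]
    norm_num
  simp only [Function.comp, Pi.smul_apply, Pi.mul_apply, smul_eq_mul, e,
    eta_I_mul hy, eta_I_mul (inv_pos.2 hy)] at h
  -- Squared norms remove the complex square roots and their branches.
  have h' := congrArg (fun z ↦ ‖z‖ ^ 2) h
  simp only [norm_mul, mul_pow, norm_inv, inv_pow, norm_sqrt, Complex.norm_I, Complex.norm_real,
    Real.norm_eq_abs, sq_abs, abs_of_pos hy] at h'
  simpa using h'

/-- Jacobi's quartic identity in terms of the eta function. -/
lemma etaImag_quartic {y : ℝ} (hy : 0 < y) :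
    etaImag (2 * y) ^ 24 = etaImag y ^ 8 * etaImag (4 * y) ^ 8 *
      (16 * etaImag (4 * y) ^ 8 + etaImag y ^ 8) := by
  have h1 := etaImag_natCast_mul 1 y
  have h2 := etaImag_natCast_mul 2 y
  have h4 := etaImag_natCast_mul 4 y
  push_cast at h1 h2 h4
  rw [one_mul] at h1
  rw [h1, h2, h4]
  set r := Real.exp (-Real.pi * y / 12) with hr
  have hr0 : 0 < r := Real.exp_pos _
  have hr1 : r < 1 := exp_neg_pi_mul_lt_one hy
  have hp0 : 0 < r ^ 24 := by positivity
  have hp1 : r ^ 24 < 1 := pow_lt_one₀ hr0.le hr1 (by norm_num)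
  have pos {n : ℕ} (hn : n ≠ 0) : 0 < eulerProd (r ^ n) :=
    eulerProd_pos (pow_nonneg hr0.le n) (pow_lt_one₀ hr0.le hr1 hn)
  have p1 := pos (n := 24) (by norm_num)
  have p2 := pos (n := 48) (by norm_num)
  have p4 := pos (n := 96) (by norm_num)
  have e1 := thetaSum_self_mul hp0 hp1
  have e2 := thetaSum_neg_one_mul hp0 hp1
  have e3 := thetaSum_one_mul hp0 hp1
  have key := thetaSum_one_pow_four hp0 hp1
  simp only [← pow_mul] at e1 e2 e3
  norm_num at e1 e2 e3 ⊢
  generalize eulerProd (r ^ 24) = a at *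
  generalize eulerProd (r ^ 48) = b at *
  generalize eulerProd (r ^ 96) = c at *
  rw [← eq_div_iff (by positivity)] at e1 e2 e3
  rw [e1, e2, e3] at key
  field_simp at key
  linear_combination r ^ 48 * key

/-- The modular equation of degree three in terms of the eta function. -/
lemma etaImag_degree_three {y : ℝ} (hy : 0 < y) :
    (etaImag (2 * y) * etaImag (6 * y)) ^ 6 =
      (etaImag y * etaImag (4 * y) * etaImag (3 * y) * etaImag (12 * y)) ^ 2 *
      (4 * (etaImag (4 * y) * etaImag (12 * y)) ^ 2 + (etaImag y * etaImag (3 * y)) ^ 2) := by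
  have h1 := etaImag_natCast_mul 1 y
  have h2 := etaImag_natCast_mul 2 y
  have h4 := etaImag_natCast_mul 4 y
  have h3 := etaImag_natCast_mul 3 y
  have h6 := etaImag_natCast_mul 6 y
  have h12 := etaImag_natCast_mul 12 y
  push_cast at h1 h2 h4 h3 h6 h12
  rw [one_mul] at h1
  rw [h1, h2, h4, h3, h6, h12]
  set r := Real.exp (-Real.pi * y / 12) with hr
  have hr0 : 0 < r := Real.exp_pos _
  have hr1 : r < 1 := exp_neg_pi_mul_lt_one hy
  have hp0 : 0 < r ^ 24 := by positivity
  have hp1 : r ^ 24 < 1 := pow_lt_one₀ hr0.le hr1 (by norm_num)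
  have hq0 : 0 < (r ^ 24) ^ 3 := by positivity
  have hq1 : (r ^ 24) ^ 3 < 1 := pow_lt_one₀ hp0.le hp1 (by norm_num)
  have pos {n : ℕ} (hn : n ≠ 0) : 0 < eulerProd (r ^ n) :=
    eulerProd_pos (pow_nonneg hr0.le n) (pow_lt_one₀ hr0.le hr1 hn)
  have p1 := pos (n := 24) (by norm_num)
  have p2 := pos (n := 48) (by norm_num)
  have p4 := pos (n := 96) (by norm_num)
  have p3 := pos (n := 72) (by norm_num)
  have p6 := pos (n := 144) (by norm_num)
  have p12 := pos (n := 288) (by norm_num)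
  have e1 := thetaSum_self_mul hp0 hp1
  have e2 := thetaSum_neg_one_mul hp0 hp1
  have e3 := thetaSum_one_mul hp0 hp1
  have f1 := thetaSum_self_mul hq0 hq1
  have f2 := thetaSum_neg_one_mul hq0 hq1
  have f3 := thetaSum_one_mul hq0 hq1
  have key := thetaSum_degree_three hp0 hp1
  simp only [← pow_mul] at e1 e2 e3 f1 f2 f3 key
  norm_num at e1 e2 e3 f1 f2 f3 key ⊢
  generalize eulerProd (r ^ 24) = a at *
  generalize eulerProd (r ^ 48) = b at *
  generalize eulerProd (r ^ 96) = c at *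
  generalize eulerProd (r ^ 72) = a' at *
  generalize eulerProd (r ^ 144) = b' at *
  generalize eulerProd (r ^ 288) = c' at *
  rw [← eq_div_iff (by positivity)] at e1 e2 e3 f1 f2 f3
  rw [e1, e2, e3, f1, f2, f3] at key
  field_simp at key
  linear_combination r ^ 48 * key

/-- The modular equation of degree five in terms of the eta function. -/
lemma etaImag_degree_five {y : ℝ} (hy : 0 < y) :
    etaImag (2 * y) ^ 4 / etaImag y ^ 2 - etaImag (10 * y) ^ 4 / etaImag (5 * y) ^ 2 =
      etaImag (2 * y) * etaImag (5 * y) ^ 3 / (etaImag y * etaImag (10 * y)) := by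
  have h1 := etaImag_natCast_mul 1 y
  have h2 := etaImag_natCast_mul 2 y
  have h5 := etaImag_natCast_mul 5 y
  have h10 := etaImag_natCast_mul 10 y
  push_cast at h1 h2 h5 h10
  rw [one_mul] at h1
  rw [h1, h2, h5, h10]
  set r := Real.exp (-Real.pi * y / 12) with hr
  have hr0 : 0 < r := Real.exp_pos _
  have hr1 : r < 1 := exp_neg_pi_mul_lt_one hy
  -- The nome is the square root of q = r ^ 24: the theta values of this identity involve only Euler
  -- products at even powers of p.
  have hp0 : 0 < r ^ 12 := by positivity
  have hp1 : r ^ 12 < 1 := pow_lt_one₀ hr0.le hr1 (by norm_num)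
  have hq0 : 0 < (r ^ 12) ^ 5 := by positivity
  have hq1 : (r ^ 12) ^ 5 < 1 := pow_lt_one₀ hp0.le hp1 (by norm_num)
  have pos {n : ℕ} (hn : n ≠ 0) : 0 < eulerProd (r ^ n) :=
    eulerProd_pos (pow_nonneg hr0.le n) (pow_lt_one₀ hr0.le hr1 hn)
  have p1 := pos (n := 24) (by norm_num)
  have p2 := pos (n := 48) (by norm_num)
  have p5 := pos (n := 120) (by norm_num)
  have p10 := pos (n := 240) (by norm_num)
  have e1 := thetaSum_self_mul hp0 hp1
  have e2 := thetaSum_self_mul hq0 hq1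
  have e3 := thetaSum_pow_five_mul hp0 hp1
  have key := thetaSum_degree_five hp0 hp1
  simp only [← pow_mul] at e1 e2 e3 key
  norm_num at e1 e2 e3 key ⊢
  generalize eulerProd (r ^ 24) = a at *
  generalize eulerProd (r ^ 48) = b at *
  generalize eulerProd (r ^ 120) = c at *
  generalize eulerProd (r ^ 240) = d at *
  rw [← eq_div_iff (by positivity)] at e1 e2 e3
  rw [e1, e2, e3] at key
  field_simp at key ⊢
  linear_combination key / 4

/-! ### Δ and the functions s₂, s₃, s₄ on the imaginary axis. -/

/-- The power 24 clears the fractional exponent of eta, leaving a function of q alone; hence the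
behaviour under τ + 1 and τ + 1/2. -/
lemma modularDelta_eq (z : ℂ) : modularDelta z = Function.Periodic.qParam 1 z *
    (∏' n : ℕ, (1 - Function.Periodic.qParam 1 z ^ (n + 1))) ^ 24 := by
  rw [modularDelta, eta, mul_pow]
  congr 1
  rw [Function.Periodic.qParam, Function.Periodic.qParam, ← Complex.exp_nat_mul]
  congr 1
  push_cast
  ring

lemma modularDelta_I_mul {y : ℝ} (hy : 0 < y) :
    modularDelta (Complex.I * y) = ((etaImag y ^ 24 : ℝ) : ℂ) := by
  rw [modularDelta, eta_I_mul hy, Complex.ofReal_pow]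

lemma modularDelta_add_one (z : ℂ) : modularDelta (z + 1) = modularDelta z := by
  have : Function.Periodic.qParam 1 (z + 1) = Function.Periodic.qParam 1 z := by
    simp only [Function.Periodic.qParam, Complex.ofReal_one, div_one, mul_add, mul_one,
      Complex.exp_add, Complex.exp_two_pi_mul_I]
  rw [modularDelta_eq, modularDelta_eq z, this]

/-- The Euler product at `-x`. -/
lemma tprod_one_add_neg_pow {x : ℝ} (h0 : 0 < x) (h1 : x < 1) :
    ∏' n : ℕ, (1 + x * (-x) ^ n) =
      eulerProd (x ^ 2) ^ 3 / (eulerProd x * eulerProd (x ^ 4)) := by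
  have hx0 : 0 ≤ x ^ 2 := sq_nonneg x
  have hx1 : x ^ 2 < 1 := pow_lt_one₀ h0.le h1 two_ne_zero
  -- Split by the parity of n: even indices give the factors 1 + x ^ (2k + 1), odd ones give 1 - x ^
  -- (2k + 2).
  have he : HasProd (fun k : ℕ ↦ 1 + x * (-x) ^ (2 * k)) (qProd x (x ^ 2)) := by
    have := (multipliable_one_add_const_mul_pow x hx0 hx1).hasProd
    rw [← qProd] at this
    simpa only [pow_mul, neg_sq] using this
  have ho : HasProd (fun k : ℕ ↦ 1 + x * (-x) ^ (2 * k + 1)) (eulerProd (x ^ 2)) := by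
    have := (multipliable_one_add_const_mul_pow (-x ^ 2) hx0 hx1).hasProd
    rw [← qProd, ← eulerProd] at this
    have e (k : ℕ) : x * (-x) ^ (2 * k + 1) = -x ^ 2 * (x ^ 2) ^ k := by
      rw [pow_succ, pow_mul, neg_sq]
      ring
    simpa only [e] using this
  have p1 := eulerProd_pos h0.le h1
  have p4 : 0 < eulerProd (x ^ 4) :=
    eulerProd_pos (pow_nonneg h0.le 4) (pow_lt_one₀ h0.le h1 four_ne_zero)
  have h := qProd_self_mul_eulerProd hx0 hx1
  have h' := qProd_self_mul_eulerProd h0.le h1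
  rw [← qProd_sq_mul_qProd h0.le h1] at h'
  rw [← pow_mul] at h
  norm_num at h
  rw [(HasProd.even_mul_odd (f := fun n : ℕ ↦ 1 + x * (-x) ^ n) he ho).tprod_eq,
    eq_div_iff (mul_pos p1 p4).ne']
  generalize eulerProd x = a at *
  generalize eulerProd (x ^ 2) = b at *
  generalize eulerProd (x ^ 4) = c at *
  linear_combination b ^ 2 * h' - qProd x (x ^ 2) * b * a * h

lemma modularDelta_I_mul_add_half {y : ℝ} (hy : 0 < y) :
    modularDelta (Complex.I * y + 1 / 2) =
      ((-(etaImag (2 * y) ^ 72 / (etaImag y * etaImag (4 * y)) ^ 24) : ℝ) : ℂ) := by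
  have h1 := etaImag_natCast_mul 1 y
  have h2 := etaImag_natCast_mul 2 y
  have h4 := etaImag_natCast_mul 4 y
  push_cast at h1 h2 h4
  rw [one_mul] at h1
  set r := Real.exp (-Real.pi * y / 12) with hr
  have hr0 : 0 < r := Real.exp_pos _
  have hr1 : r < 1 := exp_neg_pi_mul_lt_one hy
  have hx0 : 0 < r ^ 24 := by positivity
  have hx1 : r ^ 24 < 1 := pow_lt_one₀ hr0.le hr1 (by norm_num)
  have hq : Function.Periodic.qParam 1 (Complex.I * y + 1 / 2) = ((-r ^ 24 : ℝ) : ℂ) := by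
    rw [Function.Periodic.qParam, hr, ← Real.exp_nat_mul]
    push_cast
    rw [← neg_one_mul, ← Complex.exp_pi_mul_I, ← Complex.exp_add]
    congr 1
    linear_combination (2 * Real.pi * y : ℂ) * Complex.I_sq
  rw [modularDelta_eq, hq, tprod_one_sub_pow_ofReal (by rwa [abs_neg, abs_of_pos hx0]), neg_neg,
    tprod_one_add_neg_pow hx0 hx1, h1, h2, h4]
  have p1 := eulerProd_pos hx0.le hx1
  have p4 : 0 < eulerProd ((r ^ 24) ^ 4) :=
    eulerProd_pos (by positivity) (pow_lt_one₀ hx0.le hx1 four_ne_zero)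
  rw [← pow_mul] at p4
  simp only [← pow_mul]
  norm_num at p4 ⊢
  norm_cast
  generalize eulerProd (r ^ 24) = a at *
  generalize eulerProd (r ^ 48) = b at *
  generalize eulerProd (r ^ 96) = c at *
  field_simp

lemma s₂_I_mul {y : ℝ} (hy : 0 < y) : s₂ (Complex.I * y) =
    ((etaImag (2 * y) ^ 48 / (etaImag y * etaImag (4 * y)) ^ 24 : ℝ) : ℂ) := by
  have hb := etaImag_pos (show 0 < 2 * y by positivity)
  have e : (2 : ℂ) * (Complex.I * y) + 1 = Complex.I * ((2 * y : ℝ) : ℂ) + 1 := by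
    push_cast
    ring
  rw [s₂, e, modularDelta_add_one, modularDelta_I_mul (by positivity),
    modularDelta_I_mul_add_half hy, ← Complex.ofReal_div, ← Complex.ofReal_neg]
  congr 1
  field_simp

lemma s₃_I_mul {y : ℝ} (hy : 0 < y) : s₃ (Complex.I * y) =
    ((etaImag y ^ 12 / etaImag (3 * y) ^ 12 + 54 +
      729 * (etaImag (3 * y) ^ 12 / etaImag y ^ 12) : ℝ) : ℂ) := by
  have ha := etaImag_pos hy
  have hc := etaImag_pos (show 0 < 3 * y by positivity)
  have e : (3 : ℂ) * (Complex.I * y) = Complex.I * ((3 * y : ℝ) : ℂ) := by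
    push_cast
    ring
  rw [s₃, e, eta_I_mul hy, eta_I_mul (by positivity)]
  norm_cast
  field_simp
  ring

lemma s₄_I_mul {y : ℝ} (hy : 0 < y) : s₄ (Complex.I * y) =
    ((etaImag y ^ 24 / etaImag (2 * y) ^ 24 + 128 +
      4096 * (etaImag (2 * y) ^ 24 / etaImag y ^ 24) : ℝ) : ℂ) := by
  have ha := etaImag_pos hy
  have hb := etaImag_pos (show 0 < 2 * y by positivity)
  have hc := etaImag_pos (show 0 < 4 * y by positivity)
  have e : (2 : ℂ) * (Complex.I * y) = Complex.I * ((2 * y : ℝ) : ℂ) := by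
    push_cast
    ring
  have e' : (4 : ℂ) * (Complex.I * y) = Complex.I * ((4 * y : ℝ) : ℂ) := by
    push_cast
    ring
  have key := etaImag_quartic hy
  rw [s₄, e, e', modularDelta_I_mul hy, modularDelta_I_mul (by positivity), eta_I_mul hy,
    eta_I_mul (by positivity), eta_I_mul (by positivity)]
  norm_cast
  generalize etaImag y = a at *
  generalize etaImag (2 * y) = b at *
  generalize etaImag (4 * y) = c at *
  have h1 : 16 * (a * c ^ 2 / b ^ 3) ^ 4 + (b ^ 3 / (a * c ^ 2)) ^ 4 =
      (32 * c ^ 8 + a ^ 8) * a ^ 4 / b ^ 12 := by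
    field_simp
    linear_combination key
  rw [h1]
  -- The quartic identity is quadratic in c ^ 8, and completing the square eliminates c.
  have h2 : ((32 * c ^ 8 + a ^ 8) * a ^ 8) ^ 2 = a ^ 8 * (a ^ 24 + 64 * b ^ 24) := by
    linear_combination (-64 * a ^ 8) * key
  have h3 : b ^ 24 / a ^ 24 * ((32 * c ^ 8 + a ^ 8) * a ^ 4 / b ^ 12) ^ 4 =
      (((32 * c ^ 8 + a ^ 8) * a ^ 8) ^ 2) ^ 2 / (a ^ 40 * b ^ 24) := by
    field_simp
  rw [h3, h2]
  field_simp
  ring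

/-! ### Evaluation at the special points. -/

/-- The square of the eta function on the imaginary axis. -/
noncomputable def etaSq (y : ℝ) : ℝ := etaImag y ^ 2

lemma etaSq_pos {y : ℝ} (hy : 0 < y) : 0 < etaSq y := pow_pos (etaImag_pos hy) 2

/-- Working with η² keeps the inversion factor rational in v, without a square root. -/
lemma etaSq_eq_mul {u v : ℝ} (hv : 0 < v) (h : u * v = 1) : etaSq u = v * etaSq v := by
  rw [etaSq, etaSq, ← etaImag_inv_sq hv, eq_inv_of_mul_eq_one_left h]

lemma etaSq_quartic {y : ℝ} (hy : 0 < y) :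
    etaSq (2 * y) ^ 12 = etaSq y ^ 4 * etaSq (4 * y) ^ 4 *
      (16 * etaSq (4 * y) ^ 4 + etaSq y ^ 4) := by
  simp only [etaSq]
  linear_combination etaImag_quartic hy

lemma etaSq_degree_three {y : ℝ} (hy : 0 < y) :
    (etaSq (2 * y) * etaSq (6 * y)) ^ 3 =
      etaSq y * etaSq (4 * y) * etaSq (3 * y) * etaSq (12 * y) *
      (4 * (etaSq (4 * y) * etaSq (12 * y)) + etaSq y * etaSq (3 * y)) := by
  simp only [etaSq]
  linear_combination etaImag_degree_three hy

lemma s₂_eq_etaSq {y : ℝ} (hy : 0 < y) : s₂ (Complex.I * y) =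
    ((etaSq (2 * y) ^ 24 / (etaSq y * etaSq (4 * y)) ^ 12 : ℝ) : ℂ) := by
  rw [s₂_I_mul hy]
  simp only [etaSq]
  ring_nf

lemma s₃_eq_etaSq {y r : ℝ} (hy : 0 < y) (hr : etaSq y ^ 6 / etaSq (3 * y) ^ 6 = r) :
    s₃ (Complex.I * y) = ((r + 54 + 729 / r : ℝ) : ℂ) := by
  rw [s₃_I_mul hy, ← hr, etaSq, etaSq, div_div_eq_mul_div, ← mul_div_assoc]
  ring_nf

lemma s₄_eq_etaSq {y t : ℝ} (hy : 0 < y) (ht : etaSq y ^ 12 / etaSq (2 * y) ^ 12 = t) :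
    s₄ (Complex.I * y) = ((t + 128 + 4096 / t : ℝ) : ℂ) := by
  rw [s₄_I_mul hy, ← ht, etaSq, etaSq, div_div_eq_mul_div, ← mul_div_assoc]
  ring_nf

lemma sqrtNeg_div (m k : ℕ) : sqrtNeg m / k = Complex.I * ((√m / k : ℝ) : ℂ) := by
  rw [sqrtNeg]
  push_cast
  ring

/-- For `y = √3 / 2` one has `η(2iy) ^ 12 = 4 (η(iy) η(4iy)) ^ 6`, because the degree three
modular equation at `y / 3` is self-dual under inversion. -/
lemma etaSq_pow_six_of_sq_eq {y : ℝ} (hy : 0 < y) (h : y ^ 2 = 3 / 4) :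
    etaSq (2 * y) ^ 6 = 4 * (etaSq y * etaSq (4 * y)) ^ 3 := by
  have h3 := etaSq_degree_three (show 0 < y / 3 by positivity)
  rw [show 2 * (y / 3) = 2 * y / 3 by ring, show 6 * (y / 3) = 2 * y by ring,
    show 4 * (y / 3) = 4 * y / 3 by ring, show 3 * (y / 3) = y by ring,
    show 12 * (y / 3) = 4 * y by ring,
    etaSq_eq_mul (u := y / 3) (v := 4 * y) (by positivity) (by linear_combination 4 / 3 * h),
    etaSq_eq_mul (u := 2 * y / 3) (v := 2 * y) (by positivity) (by linear_combination 4 / 3 * h),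
    etaSq_eq_mul (u := 4 * y / 3) (v := y) (by positivity) (by linear_combination 4 / 3 * h)]
    at h3
  have hy3 : 8 * y ^ 3 ≠ 0 := by positivity
  refine mul_left_cancel₀ hy3 ?_
  linear_combination h3

lemma s₂_value_one : s₂ (sqrtNeg 1 / 2) = 64 := by
  have hy : (0 : ℝ) < 1 / 2 := by norm_num
  have e : sqrtNeg 1 / 2 = Complex.I * ((1 / 2 : ℝ) : ℂ) := by
    simpa using sqrtNeg_div 1 2
  have h := etaSq_quartic hy
  have hc := etaSq_pos (show (0 : ℝ) < 4 * (1 / 2) by norm_num)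
  rw [e, s₂_eq_etaSq hy, show (64 : ℂ) = ((64 : ℝ) : ℂ) by norm_num]
  -- Inversion swaps y = 1/2 with 4y = 2, so the quartic identity fixes the ratio of b to c.
  rw [etaSq_eq_mul (u := 1 / 2) (v := 4 * (1 / 2)) (by norm_num) (by norm_num)] at h ⊢
  congr 1
  generalize etaSq (2 * (1 / 2)) = b at *
  generalize etaSq (4 * (1 / 2)) = c at *
  rw [show b ^ 24 = (b ^ 12) ^ 2 by ring, h]
  field_simp
  ring

lemma s₂_value_three : s₂ (sqrtNeg 3 / 2) = 256 := by
  have e : sqrtNeg 3 / 2 = Complex.I * ((√3 / 2 : ℝ) : ℂ) := by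
    simpa using sqrtNeg_div 3 2
  have h3 : (√3) ^ 2 = 3 := Real.sq_sqrt (by norm_num)
  have hy : 0 < √3 / 2 := by positivity
  have h := etaSq_pow_six_of_sq_eq hy (by linear_combination h3 / 4)
  have ha := etaSq_pos hy
  have hc := etaSq_pos (show 0 < 4 * (√3 / 2) by positivity)
  rw [e, s₂_eq_etaSq hy, show (256 : ℂ) = ((256 : ℝ) : ℂ) by norm_num]
  congr 1
  rw [show etaSq (2 * (√3 / 2)) ^ 24 = (etaSq (2 * (√3 / 2)) ^ 6) ^ 4 by ring, h]
  generalize etaSq (√3 / 2) = a at *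
  generalize etaSq (4 * (√3 / 2)) = c at *
  field_simp
  ring

/-- The point is fixed by τ ↦ -1/(3τ), so inversion alone gives the eta ratio (√3) ^ 6 = 27. -/
lemma s₃_value_three : s₃ (sqrtNeg 3 / 3) = 108 := by
  have e : sqrtNeg 3 / 3 = Complex.I * ((√3 / 3 : ℝ) : ℂ) := by
    simpa using sqrtNeg_div 3 3
  have h3 : (√3) ^ 2 = 3 := Real.sq_sqrt (by norm_num)
  have hy : 0 < √3 / 3 := by positivity
  have hc := etaSq_pos (show 0 < 3 * (√3 / 3) by positivity)
  rw [e, s₃_eq_etaSq hy (r := 27)]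
  · norm_num
  · rw [etaSq_eq_mul (u := √3 / 3) (v := 3 * (√3 / 3)) (by positivity)
      (by linear_combination h3 / 3)]
    rw [div_eq_iff (by positivity)]
    linear_combination etaSq (3 * (√3 / 3)) ^ 6 * (√3 ^ 4 + 3 * √3 ^ 2 + 9) * h3

lemma s₃_value_twelve : s₃ (sqrtNeg 12 / 3) = 1458 := by
  have h3 : (√3) ^ 2 = 3 := Real.sq_sqrt (by norm_num)
  have e : sqrtNeg 12 / 3 = Complex.I * ((4 * (√3 / 2) / 3 : ℝ) : ℂ) := by
    have : √12 = 2 * √3 := by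
      rw [show (12 : ℝ) = 2 ^ 2 * 3 by norm_num, Real.sqrt_mul (by norm_num),
        Real.sqrt_sq (by norm_num)]
    have h := sqrtNeg_div 12 3
    push_cast at h
    rw [h, this]
    push_cast
    ring
  have hy : 0 < √3 / 2 := by positivity
  have h6 := etaSq_pow_six_of_sq_eq hy (by linear_combination h3 / 4)
  have h4 := etaSq_quartic hy
  have ha := etaSq_pos hy
  have hc := etaSq_pos (show 0 < 4 * (√3 / 2) by positivity)
  have hinv := etaSq_eq_mul (u := 4 * (√3 / 2) / 3) hy (by linear_combination h3 / 3)
  rw [e, s₃_eq_etaSq (by positivity) rfl, show (1458 : ℂ) = ((1458 : ℝ) : ℂ) by norm_num, hinv,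
    show 3 * (4 * (√3 / 2) / 3) = 4 * (√3 / 2) by ring]
  congr 1
  generalize etaSq (√3 / 2) = a at *
  generalize etaSq (2 * (√3 / 2)) = b at *
  generalize etaSq (4 * (√3 / 2)) = c at *
  -- The factor 4 makes the resulting quadratic x² - 4x + 1 reciprocal, matching the shape r + 729 /
  -- r with r = 27x³.
  obtain ⟨x, hx0, hx⟩ : ∃ x : ℝ, 0 < x ∧ a ^ 2 = 4 * x * c ^ 2 :=
    ⟨a ^ 2 / (4 * c ^ 2), by positivity, by field_simp⟩
  have hxq : x ^ 2 - 4 * x + 1 = 0 := by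
    rw [show b ^ 12 = (b ^ 6) ^ 2 by ring, h6] at h4
    have : 16 * a ^ 4 * c ^ 8 ≠ 0 := by positivity
    refine (mul_eq_zero.1 ?_).resolve_left this
    have hx2 : a ^ 4 = 16 * x ^ 2 * c ^ 4 := by
      rw [show a ^ 4 = (a ^ 2) ^ 2 by ring, hx]; ring
    linear_combination -h4 - a ^ 4 * c ^ 4 * hx2 + 16 * a ^ 4 * c ^ 6 * hx
  have hr : (√3 / 2 * a) ^ 6 / c ^ 6 = 27 * x ^ 3 := by
    rw [div_eq_iff (by positivity), show (√3 / 2 * a) ^ 6 = (√3 ^ 2) ^ 3 * (a ^ 2) ^ 3 / 64 by ring,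
      hx, h3]
    ring
  rw [hr]
  field_simp
  linear_combination (729 * (x ^ 4 + 4 * x ^ 3 + 15 * x ^ 2 + 4 * x + 1)) * hxq

/-- The point is fixed by τ ↦ -1/(2τ), whence the eta ratio (√2) ^ 12 = 64. -/
lemma s₄_value_two : s₄ (sqrtNeg 2 / 2) = 256 := by
  have e : sqrtNeg 2 / 2 = Complex.I * ((√2 / 2 : ℝ) : ℂ) := by
    simpa using sqrtNeg_div 2 2
  have h2 : (√2) ^ 2 = 2 := Real.sq_sqrt (by norm_num)
  have hy : 0 < √2 / 2 := by positivity
  have hc := etaSq_pos (show 0 < 2 * (√2 / 2) by positivity)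
  rw [e, s₄_eq_etaSq hy (t := 64)]
  · norm_num
  · rw [etaSq_eq_mul (u := √2 / 2) (v := 2 * (√2 / 2)) (by positivity)
      (by linear_combination h2 / 2), div_eq_iff (by positivity),
      show (2 * (√2 / 2) * etaSq (2 * (√2 / 2))) ^ 12 =
        (√2 ^ 2) ^ 6 * etaSq (2 * (√2 / 2)) ^ 12 by ring, h2]
    norm_num

lemma s₄_value_four : s₄ (sqrtNeg 4 / 2) = 648 := by
  have e : sqrtNeg 4 / 2 = Complex.I * ((1 : ℝ) : ℂ) := by
    have : √4 = 2 := by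
      rw [show (4 : ℝ) = 2 ^ 2 by norm_num, Real.sqrt_sq (by norm_num)]
    have h := sqrtNeg_div 4 2
    push_cast at h
    rw [h, this]
    norm_num
  -- Taken at 1/2 rather than 1, since the outer arguments 1/2 and 2 are exchanged by inversion
  -- while the middle one is 1.
  have h := etaSq_quartic (show (0 : ℝ) < 1 / 2 by norm_num)
  have hc := etaSq_pos (show (0 : ℝ) < 2 by norm_num)
  rw [e, s₄_eq_etaSq one_pos (t := 512)]
  · norm_num
  · rw [etaSq_eq_mul (u := 1 / 2) (v := 2) (by norm_num) (by norm_num)] at h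
    norm_num at h ⊢
    rw [h]
    field_simp
    ring

/-- With y = √10/10, inversion exchanges y with 10y and 2y with 5y, so the degree five equation
constrains the single ratio x of η² at 5y and 10y. -/
lemma s₄_value_ten : s₄ (sqrtNeg 10 / 2) = 20736 := by
  have e : sqrtNeg 10 / 2 = Complex.I * ((5 * (√10 / 10) : ℝ) : ℂ) := by
    have h := sqrtNeg_div 10 2
    push_cast at h
    rw [h]
    push_cast
    ring
  have hs : (√10) ^ 2 = 10 := Real.sq_sqrt (by norm_num)
  have hs0 : 0 < √10 := by positivity
  have hy : 0 < √10 / 10 := by positivity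
  have h := etaImag_degree_five hy
  have pa := etaImag_pos hy
  have pb := etaImag_pos (show 0 < 2 * (√10 / 10) by positivity)
  have pc := etaImag_pos (show 0 < 5 * (√10 / 10) by positivity)
  have pd := etaImag_pos (show 0 < 10 * (√10 / 10) by positivity)
  have h1 := etaSq_eq_mul (u := √10 / 10) (v := 10 * (√10 / 10)) (by positivity)
    (by linear_combination hs / 10)
  have h2 := etaSq_eq_mul (u := 2 * (√10 / 10)) (v := 5 * (√10 / 10)) (by positivity)
    (by linear_combination hs / 10)
  rw [e, s₄_eq_etaSq (by positivity) rfl, show (20736 : ℂ) = ((20736 : ℝ) : ℂ) by norm_num,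
    show 2 * (5 * (√10 / 10)) = 10 * (√10 / 10) by ring]
  congr 1
  simp only [etaSq] at *
  generalize etaImag (√10 / 10) = a at *
  generalize etaImag (2 * (√10 / 10)) = b at *
  generalize etaImag (5 * (√10 / 10)) = c at *
  generalize etaImag (10 * (√10 / 10)) = d at *
  generalize √10 = s at *
  obtain ⟨w, hw0, hw⟩ : ∃ w : ℝ, 0 < w ∧ b * c = w * (a * d) :=
    ⟨b * c / (a * d), by positivity, by field_simp⟩
  obtain ⟨x, hx0, hx⟩ : ∃ x : ℝ, 0 < x ∧ c ^ 2 = x * d ^ 2 :=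
    ⟨c ^ 2 / d ^ 2, by positivity, by field_simp⟩
  have hwx : 2 * w ^ 2 = x ^ 2 := by
    refine mul_right_cancel₀ (show s * d ^ 4 ≠ 0 by positivity) ?_
    linear_combination 2 * w ^ 2 * d ^ 2 * (-h1) - 2 * (b * c + w * (a * d)) * hw +
      2 * c ^ 2 * h2 + s * (c ^ 2 + x * d ^ 2) * hx
  have hcub : x ^ 2 * (s * x - 4 * w) = 4 := by
    have e1 : b ^ 4 / a ^ 2 = s / 4 * x ^ 2 * d ^ 2 := by
      rw [show b ^ 4 = (b ^ 2) ^ 2 by ring, h2, hx, h1]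
      field_simp
      ring
    have e2 : d ^ 4 / c ^ 2 = d ^ 2 / x := by
      rw [hx]
      field_simp
    have e3 : b * c ^ 3 / (a * d) = w * (x * d ^ 2) := by
      rw [show b * c ^ 3 = b * c * c ^ 2 by ring, hw, hx]
      field_simp
    rw [e1, e2, e3] at h
    field_simp at h
    linear_combination h
  have ht : (c ^ 2) ^ 12 / (d ^ 2) ^ 12 = x ^ 12 := by
    rw [hx, mul_pow, mul_div_assoc, div_self (by positivity), mul_one]
  rw [ht]
  -- Squaring away s = √10 and then w leaves a polynomial in x ^ 6; one more conjugation, x ^ 6 ↦ -x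
  -- ^ 6, passes to x ^ 12.
  have h6 : x ^ 6 - 8 = 16 * w * x ^ 2 := by
    linear_combination ((s * x ^ 3 + (4 + 4 * w * x ^ 2)) * hcub - x ^ 6 * hs +
      8 * x ^ 4 * hwx) / 2
  have h12 : x ^ 12 - 144 * x ^ 6 + 64 = 0 := by
    linear_combination (x ^ 6 - 8 + 16 * w * x ^ 2) * h6 + 128 * x ^ 4 * hwx
  have hpoly : x ^ 24 - 20608 * x ^ 12 + 4096 = 0 := by
    linear_combination (x ^ 12 + 64 + 144 * x ^ 6) * h12
  field_simp
  linear_combination hpoly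

/-- The ratio of eta values at the points `√-6 / 2` and `√-6`. -/
lemma etaSq_ratio_six : ∃ x : ℝ, 0 < x ∧
    etaSq (3 * (√6 / 6)) = x * etaSq (6 * (√6 / 6)) ∧ x ^ 24 - 2176 * x ^ 12 + 4096 = 0 := by
  have hs : (√6) ^ 2 = 6 := Real.sq_sqrt (by norm_num)
  have hs0 : 0 < √6 := by positivity
  have hy : 0 < √6 / 6 := by positivity
  have h3 := etaSq_degree_three hy
  have hq := etaSq_quartic hy
  have hq' := etaSq_quartic (show 0 < 3 * (√6 / 6) by positivity)
  rw [show 2 * (3 * (√6 / 6)) = 6 * (√6 / 6) by ring,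
    show 4 * (3 * (√6 / 6)) = 12 * (√6 / 6) by ring] at hq'
  have h1 := etaSq_eq_mul (u := √6 / 6) (v := 6 * (√6 / 6)) (by positivity)
    (by linear_combination hs / 6)
  have h2 := etaSq_eq_mul (u := 2 * (√6 / 6)) (v := 3 * (√6 / 6)) (by positivity)
    (by linear_combination hs / 6)
  have pc := etaSq_pos (show 0 < 4 * (√6 / 6) by positivity)
  have pa' := etaSq_pos (show 0 < 3 * (√6 / 6) by positivity)
  have pb' := etaSq_pos (show 0 < 6 * (√6 / 6) by positivity)
  have pc' := etaSq_pos (show 0 < 12 * (√6 / 6) by positivity)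
  rw [h1, h2] at h3 hq
  rw [mul_div_cancel₀ _ (by norm_num : (6 : ℝ) ≠ 0)] at *
  generalize etaSq (4 * (√6 / 6)) = c at *
  generalize etaSq (3 * (√6 / 6)) = a' at *
  generalize etaSq √6 = b' at *
  generalize etaSq (12 * (√6 / 6)) = c' at *
  generalize √6 = s at *
  obtain ⟨x, hx0, rfl⟩ : ∃ x : ℝ, 0 < x ∧ a' = x * b' :=
    ⟨a' / b', by positivity, by field_simp⟩
  obtain ⟨z, hz0, rfl⟩ : ∃ z : ℝ, 0 < z ∧ c = z * b' :=
    ⟨c / b', by positivity, by field_simp⟩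
  -- This scaling cancels x and z from the degree three equation, leaving a quadratic in d over
  -- ℚ(√6).
  obtain ⟨d, hd0, rfl⟩ : ∃ d : ℝ, 0 < d ∧ c' = d * x / z * b' :=
    ⟨c' / b' / x * z, by positivity, by field_simp⟩
  refine ⟨x, hx0, rfl, ?_⟩
  have hd : 16 * d ^ 2 + 4 * s * d - 3 = 0 := by
    field_simp at h3
    linear_combination -h3 / 54 + hs / 2
  have hμ : (256 * d ^ 4 / 9) ^ 2 - 14 * (256 * d ^ 4 / 9) + 1 = 0 := by
    have : 256 * d ^ 4 - 192 * d ^ 2 + 9 = 0 := by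
      linear_combination (16 * d ^ 2 - 3 - 4 * s * d) * hd + 16 * d ^ 2 * hs
    linear_combination (256 * d ^ 4 + 9 + 192 * d ^ 2) / 81 * this
  have hX : x ^ 12 = 256 * (4 * z ^ 4 / 9) * (4 * z ^ 4 / 9 + 1) := by
    have hs4 : s ^ 4 = 36 := by linear_combination (s ^ 2 + 6) * hs
    have hs12 : s ^ 12 = 46656 := by linear_combination (s ^ 8 + 36 * s ^ 4 + 1296) * hs4
    refine mul_left_cancel₀ (show b' ^ 12 ≠ 0 by positivity) ?_
    linear_combination 64 / 729 * hq - 64 / 729 * (x ^ 12 * b' ^ 12 / 4096) * hs12 +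
      64 / 729 * z ^ 4 * b' ^ 12 * (16 * z ^ 4 + s ^ 4 + 36) * hs4
  have hZ : z ^ 8 = x ^ 12 * d ^ 4 * (16 * d ^ 4 + z ^ 4) := by
    field_simp at hq'
    linear_combination hq'
  have hL : 4 * z ^ 4 / 9 = (4 * z ^ 4 / 9 + 1) * (256 * d ^ 4 / 9) *
      (256 * d ^ 4 / 9 + 4 * (4 * z ^ 4 / 9)) := by
    rw [hX] at hZ
    refine mul_left_cancel₀ (show 9 / 4 * z ^ 4 ≠ 0 by positivity) ?_
    linear_combination hZ
  rw [show x ^ 24 = (x ^ 12) ^ 2 by ring, hX]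
  generalize 4 * z ^ 4 / 9 = l at *
  generalize 256 * d ^ 4 / 9 = μ at *
  -- Subtracting a multiple of the quadratic for μ leaves an equation linear in μ; eliminating μ
  -- then gives a polynomial in l(l + 1), that is, in x ^ 12.
  have hP : μ * ((l + 1) * (4 * l + 14)) - (2 * l + 1) = 0 := by
    linear_combination -hL - (l + 1) * hμ
  linear_combination 4096 * ((l + 1) ^ 2 * (4 * l + 14) ^ 2 * hμ -
    (μ * ((l + 1) * (4 * l + 14)) + (2 * l + 1)) * hP + 14 * ((l + 1) * (4 * l + 14)) * hP)

lemma s₃_value_six : s₃ (sqrtNeg 6 / 3) = 216 := by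
  have e : sqrtNeg 6 / 3 = Complex.I * ((2 * (√6 / 6) : ℝ) : ℂ) := by
    have h := sqrtNeg_div 6 3
    push_cast at h
    rw [h]
    push_cast
    ring
  have hs : (√6) ^ 2 = 6 := Real.sq_sqrt (by norm_num)
  have pb := etaSq_pos (show 0 < 6 * (√6 / 6) by positivity)
  have h2 := etaSq_eq_mul (u := 2 * (√6 / 6)) (v := 3 * (√6 / 6)) (by positivity)
    (by linear_combination hs / 6)
  obtain ⟨x, hx0, hx, hpoly⟩ := etaSq_ratio_six
  rw [e, s₃_eq_etaSq (by positivity) rfl, show (216 : ℂ) = ((216 : ℝ) : ℂ) by norm_num, h2, hx,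
    show 3 * (2 * (√6 / 6)) = 6 * (√6 / 6) by ring]
  congr 1
  generalize etaSq (6 * (√6 / 6)) = b at *
  have hr : (3 * (√6 / 6) * (x * b)) ^ 6 / b ^ 6 = 27 / 8 * x ^ 6 := by
    rw [div_eq_iff (by positivity),
      show (3 * (√6 / 6) * (x * b)) ^ 6 = (√6 ^ 2) ^ 3 / 64 * x ^ 6 * b ^ 6 by ring, hs]
    ring
  -- The polynomial splits into two quadratics in x ^ 6, one of which is positive.
  have h12 : x ^ 12 - 48 * x ^ 6 + 64 = 0 := by
    have : x ^ 12 + 48 * x ^ 6 + 64 ≠ 0 := by positivity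
    refine (mul_eq_zero.1 ?_).resolve_right this
    linear_combination hpoly
  rw [hr]
  field_simp
  linear_combination 729 * h12

lemma s₄_value_six : s₄ (sqrtNeg 6 / 2) = 2304 := by
  have e : sqrtNeg 6 / 2 = Complex.I * ((3 * (√6 / 6) : ℝ) : ℂ) := by
    have h := sqrtNeg_div 6 2
    push_cast at h
    rw [h]
    push_cast
    ring
  have pb := etaSq_pos (show 0 < 6 * (√6 / 6) by positivity)
  obtain ⟨x, hx0, hx, hpoly⟩ := etaSq_ratio_six
  rw [e, s₄_eq_etaSq (by positivity) rfl, show (2304 : ℂ) = ((2304 : ℝ) : ℂ) by norm_num, hx,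
    show 2 * (3 * (√6 / 6)) = 6 * (√6 / 6) by ring, mul_pow, mul_div_assoc,
    div_self (by positivity), mul_one]
  congr 1
  field_simp
  linear_combination hpoly

/-- With y = √2/2, inversion relates y and 2y. The quartic identities at y and 3y and the degree
three equation at y then determine the ratio at 3y and 6y. -/
lemma s₄_value_eighteen : s₄ (sqrtNeg 18 / 2) = 614656 := by
  have e : sqrtNeg 18 / 2 = Complex.I * ((3 * (√2 / 2) : ℝ) : ℂ) := by
    have : √18 = 3 * √2 := by
      rw [show (18 : ℝ) = 3 ^ 2 * 2 by norm_num, Real.sqrt_mul (by norm_num),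
        Real.sqrt_sq (by norm_num)]
    have h := sqrtNeg_div 18 2
    push_cast at h
    rw [h, this]
    push_cast
    ring
  have hs : (√2) ^ 2 = 2 := Real.sq_sqrt (by norm_num)
  have hs0 : 0 < √2 := by positivity
  have hy : 0 < √2 / 2 := by positivity
  have h3 := etaSq_degree_three hy
  have hq := etaSq_quartic hy
  have hq' := etaSq_quartic (show 0 < 3 * (√2 / 2) by positivity)
  have h1 := etaSq_eq_mul (u := √2 / 2) (v := 2 * (√2 / 2)) (by positivity)
    (by linear_combination hs / 2)
  have pb := etaSq_pos (show 0 < 2 * (√2 / 2) by positivity)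
  have pc := etaSq_pos (show 0 < 4 * (√2 / 2) by positivity)
  have pa' := etaSq_pos (show 0 < 3 * (√2 / 2) by positivity)
  have pb' := etaSq_pos (show 0 < 6 * (√2 / 2) by positivity)
  have pc' := etaSq_pos (show 0 < 12 * (√2 / 2) by positivity)
  rw [e, s₄_eq_etaSq (by positivity) rfl, show (614656 : ℂ) = ((614656 : ℝ) : ℂ) by norm_num,
    show 2 * (3 * (√2 / 2)) = 6 * (√2 / 2) by ring]
  rw [show 2 * (3 * (√2 / 2)) = 6 * (√2 / 2) by ring,
    show 4 * (3 * (√2 / 2)) = 12 * (√2 / 2) by ring] at hq'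
  rw [h1] at h3 hq
  congr 1
  rw [mul_div_cancel₀ _ (by norm_num : (2 : ℝ) ≠ 0)] at *
  generalize etaSq √2 = b at *
  generalize etaSq (4 * (√2 / 2)) = c at *
  generalize etaSq (3 * (√2 / 2)) = a' at *
  generalize etaSq (6 * (√2 / 2)) = b' at *
  generalize etaSq (12 * (√2 / 2)) = c' at *
  generalize √2 = s at *
  obtain ⟨x, hx0, rfl⟩ : ∃ x : ℝ, 0 < x ∧ a' = x * b' :=
    ⟨a' / b', by positivity, by field_simp⟩
  obtain ⟨z, hz0, rfl⟩ : ∃ z : ℝ, 0 < z ∧ c = z * b :=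
    ⟨c / b, by positivity, by field_simp⟩
  -- This scaling removes z from the degree three equation, which then reads x ^ 12 (m(1 + m)) ^ 4 =
  -- 4 after a fourth power.
  obtain ⟨m, hm0, rfl⟩ : ∃ m : ℝ, 0 < m ∧ c' = m * s * x / (4 * z) * b' :=
    ⟨4 * z * c' / (s * x * b'), by positivity, by field_simp⟩
  have hs4 : s ^ 4 = 4 := by linear_combination (s ^ 2 + 2) * hs
  have hν : (8 * z ^ 4) ^ 2 + 2 * (8 * z ^ 4) - 1 = 0 := by
    refine mul_left_cancel₀ (show b ^ 12 ≠ 0 by positivity) ?_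
    linear_combination -hq - z ^ 4 * b ^ 12 * (16 * z ^ 4 + s ^ 4 + 4) * hs4
  have hm : x ^ 12 * (m * (1 + m)) ^ 4 = 4 := by
    have hs12 : s ^ 12 = 64 := by linear_combination (s ^ 8 + 4 * s ^ 4 + 16) * hs4
    have h4 : s ^ 3 * x ^ 3 * (m * (1 + m)) = 4 := by
      field_simp at h3
      linear_combination -h3
    have h256 : (s ^ 3 * x ^ 3 * (m * (1 + m))) ^ 4 = 256 := by
      rw [h4]
      norm_num
    linear_combination h256 / 64 - x ^ 12 * (m * (1 + m)) ^ 4 / 64 * hs12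
  have hx : x ^ 12 * m ^ 4 * (2 * m ^ 4 + 8 * z ^ 4) = 8 * (8 * z ^ 4) ^ 2 := by
    have hc : (m * s * x / (4 * z)) ^ 4 = m ^ 4 * x ^ 4 / (64 * z ^ 4) := by
      rw [div_pow, show (m * s * x) ^ 4 = m ^ 4 * s ^ 4 * x ^ 4 by ring, hs4]
      field_simp
      ring
    rw [mul_pow (m * s * x / (4 * z)) b' 4, hc] at hq'
    field_simp at hq'
    linear_combination -hq' / 8
  have hν0 : 0 < 8 * z ^ 4 := by positivity
  generalize 8 * z ^ 4 = ν at *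
  have hquart : 2 * m ^ 4 + ν = 2 * ν ^ 2 * (1 + m) ^ 4 := by
    refine mul_left_cancel₀ (show x ^ 12 * m ^ 4 ≠ 0 by positivity) ?_
    linear_combination hx - 2 * ν ^ 2 * hm
  -- Modulo the quadratic for ν, the quartic in m factors over ℚ(ν); the other factor is positive.
  have hquad : m ^ 2 - (2 * ν + 1) * m + (1 - 2 * ν) / 2 = 0 := by
    have : 4 * ν * (m ^ 2 + m + 1 / 2) ≠ 0 := by positivity
    refine (mul_eq_zero.1 ?_).resolve_left this
    linear_combination hquart + 2 * m ^ 4 * hν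
  -- This is the norm of `hquad` under the conjugation ν ↦ -2 - ν; it depends on m only through m(1
  -- + m).
  have hn : 4 * (m * (1 + m)) ^ 2 - 20 * (m * (1 + m)) + 1 = 0 := by
    linear_combination 4 * (m ^ 2 + (2 * ν + 3) * m + (5 + 2 * ν) / 2) * hquad +
      (16 * m ^ 2 + 16 * m + 4) * hν
  have hn0 : 0 < m * (1 + m) := by positivity
  generalize m * (1 + m) = n at *
  rw [mul_pow, mul_div_assoc, div_self (by positivity), mul_one,
    show x ^ 12 = 4 / n ^ 4 by field_simp; linear_combination hm]
  field_simp
  linear_combination 16 * (16 * n ^ 4 + 1 + 392 * n ^ 2) * (4 * n ^ 2 + 1 + 20 * n) * hn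

theorem lemma4 :
    (s₂ (sqrtNeg 1 / 2) = 64 ∧
      s₂ (sqrtNeg 3 / 2) = 256) ∧
    (s₃ (sqrtNeg 3 / 3) = 108 ∧
      s₃ (sqrtNeg 6 / 3) = 216 ∧
      s₃ (sqrtNeg 12 / 3) = 1458) ∧
    (s₄ (sqrtNeg 2 / 2) = 256 ∧
      s₄ (sqrtNeg 4 / 2) = 648 ∧
      s₄ (sqrtNeg 6 / 2) = 2304 ∧
      s₄ (sqrtNeg 10 / 2) = 20736 ∧
      s₄ (sqrtNeg 18 / 2) = 614656) :=
  ⟨⟨s₂_value_one, s₂_value_three⟩, ⟨s₃_value_three, s₃_value_six, s₃_value_twelve⟩,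
    s₄_value_two, s₄_value_four, s₄_value_six, s₄_value_ten, s₄_value_eighteen⟩
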